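/- Let $k$ be a field of characteristic different from $2$; all vector spaces and (multi)linear maps are over $k$. **2-term homotopy Lie triple systems.** Such an object $\mathcal T$ consists of a complex $d:T_{-1}\to T_0$, trilinear brackets $[x,y,z]\in T_0$ and $[f,x,y],[x,f,y],[x,y,f]\in T_{-1}$ ($x,y,z\in T_0$, $f\in T_{-1}$), and a 5-linear map $J:T_0^5\to T_{-1}$, such that for all $x,y,z,x_i\in T_0$ and $f,g\in T_{-1}$: - $d[x,y,f]=[x,y,df]$, $d[x,f,y]=[x,df,y]$, $[df,g,x]=[f,dg,x]$, $[df,x,g]=[f,x,dg]$; - $[x,y,z]=-[y,x,z]$, $[x,y,f]=-[y,x,f]$, $[x,f,y]=-[f,x,y]$; - $[x,y,z]+[y,z,x]+[z,x,y]=0$, $[x,y,f]+[y,f,x]+[f,x,y]=0$; - $J(x_1,x_2,x,x,y)=0$ and $J(x_1,x_2,x,y,z)+J(x_1,x_2,y,z,x)+J(x_1,x_2,z,x,y)=0$; - with $E(x_1,\dots,x_5)=-[x_1,x_2,[x_3,x_4,x_5]]+[x_3,[x_1,x_2,x_4],x_5]+[[x_1,x_2,x_3],x_4,x_5]+[x_3,x_4,[x_1,x_2,x_5]]$: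 $dJ=E$ on $T_0^5$, and $J(\dots,df,\dots)=E(\dots,f,\dots)$ when a single argument, in position $1$, $2$, $3$ or $5$, is $df$ resp. $f\in T_{-1}$; - $[J(x_1,x_2,x_3,x_4,x_5),x_6,x_7]+[x_5,J(x_1,x_2,x_3,x_4,x_6),x_7]+[x_1,x_2,J(x_3,x_4,x_5,x_6,x_7)]+[x_5,x_6,J(x_1,x_2,x_3,x_4,x_7)]+J(x_1,x_2,[x_3,x_4,x_5],x_6,x_7)+J(x_1,x_2,x_5,[x_3,x_4,x_6],x_7)+J(x_1,x_2,x_5,x_6,[x_3,x_4,x_7])$ $=[x_3,x_4,J(x_1,x_2,x_5,x_6,x_7)]+J([x_1,x_2,x_3],x_4,x_5,x_6,x_7)+J(x_3,[x_1,x_2,x_4],x_5,x_6,x_7)+J(x_3,x_4,[x_1,x_2,x_5],x_6,x_7)+J(x_3,x_4,x_5,[x_1,x_2,x_6],x_7)+J(x_1,x_2,x_3,x_4,[x_5,x_6,x_7])+J(x_3,x_4,x_5,x_6,[x_1,x_2,x_7])$. A *homomorphism* $\varphi:\mathcal T\to\mathcal T'$ is a chain map $(\varphi_0,\varphi_1)$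 with a trilinear map $\varphi_2:T_0^3\to T'_{-1}$ such that $\varphi_2(x,x,y)=0$, $\varphi_2(x,y,z)+\varphi_2(y,z,x)+\varphi_2(z,x,y)=0$, $d\varphi_2(x,y,z)=\varphi_0[x,y,z]-[\varphi_0x,\varphi_0y,\varphi_0z]$, $\varphi_2(x,y,df)=\varphi_1[x,y,f]-[\varphi_0x,\varphi_0y,\varphi_1f]$, $\varphi_2(x,df,y)=\varphi_1[x,f,y]-[\varphi_0x,\varphi_1f,\varphi_0y]$, and $$J(\varphi_0x_1,\dots,\varphi_0x_5)+[\varphi_2(x_1,x_2,x_3),\varphi_0x_4,\varphi_0x_5]+[\varphi_0x_3,\varphi_2(x_1,x_2,x_4),\varphi_0x_5]+[\varphi_0x_3,\varphi_0x_4,\varphi_2(x_1,x_2,x_5)]$$ $$+\varphi_2([x_1,x_2,x_3],x_4,x_5)+\varphi_2(x_3,[x_1,x_2,x_4],x_5)+\varphi_2(x_3,x_4,[x_1,x_2,x_5])$$ $$=[\varphi_0x_1,\varphi_0x_2,\varphi_2(x_3,x_4,x_5)]+\varphi_2(x_1,x_2,[x_3,x_4,x_5])+\varphi_1J(x_1,\dots,x_5).$$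 Composition: $(\psi\varphi)_i=\psi_i\varphi_i$ for $i=0,1$, and $(\psi\varphi)_2(x,y,z)=\psi_2(\varphi_0x,\varphi_0y,\varphi_0z)+\psi_1\varphi_2(x,y,z)$; the identity is $(1,1,0)$. A *2-homomorphism* $\tau:\varphi\Rightarrow\psi$ is a linear map $\tau:T_0\to T'_{-1}$ with $d\tau=\psi_0-\varphi_0$, $\tau d=\psi_1-\varphi_1$ and $$\varphi_2(x,y,z)-\psi_2(x,y,z)=[\varphi_0x,\varphi_0y,\tau z]+[\varphi_0x,\tau y,\varphi_0z]+[\tau x,\varphi_0y,\varphi_0z]+[d\tau x,\tau y,\varphi_0z]+[d\tau x,\varphi_0y,\tau z]+[\varphi_0x,d\tau y,\tau z]+[d\tau x,d\tau y,\tau z]-\tau[x,y,z].$$ Vertical composition is addition. The horizontal composite of $\tau:\varphi\Rightarrow\psi$ followed by $\tau':\varphi'\Rightarrow\psi'$ is $\tau'\psi_0+\varphi'_1\tau$. **Lie triple 2-systems.** A 2-vector space is a category internal to $k$-vector spaces (objects $L_0$, morphisms $L_1$, source $s$, target $t$, identities $1_x$, linear composition). A *Lie triple 2-system* is a 2-vector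 space $L$ with a trilinear functor $\{\cdot,\cdot,\cdot\}:L\times L\times L\to L$ satisfying $\{x,x,y\}=0$ and $\{x,y,z\}+\{y,z,x\}+\{z,x,y\}=0$ on objects and on morphisms, and a 5-linear natural isomorphism (the fundamentor) $$\mathcal J_{x_1,\dots,x_5}:\{x_1,x_2,\{x_3,x_4,x_5\}\}\to\{\{x_1,x_2,x_3\},x_4,x_5\}+\{x_3,\{x_1,x_2,x_4\},x_5\}+\{x_3,x_4,\{x_1,x_2,x_5\}\}$$ with $\mathcal J_{x_1,x_2,x,x,y}=0$ and $\mathcal J_{x_1,x_2,x,y,z}+\mathcal J_{x_1,x_2,y,z,x}+\mathcal J_{x_1,x_2,z,x,y}=0$, such that, for all $x_1,\dots,x_7$, the following two composites from $\{x_1,x_2,\{x_3,x_4,\{x_5,x_6,x_7\}\}\}$ agree (identities on unchanged summands are suppressed; an object among morphisms means its identity): - first $\{x_1,x_2,\mathcal J_{x_3,x_4,x_5,x_6,x_7}\}$, then $\mathcal J_{x_1,x_2,\{x_3,x_4,x_5\},x_6,x_7}+\mathcal J_{x_1,x_2,x_5,\{x_3,x_4,x_6\},x_7}+\mathcal J_{x_1,x_2,x_5,x_6,\{x_3,x_4,x_7\}}$,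 then $\{x_5,x_6,\mathcal J_{x_1,x_2,x_3,x_4,x_7}\}$, then $\{x_5,\mathcal J_{x_1,x_2,x_3,x_4,x_6},x_7\}+\{\mathcal J_{x_1,x_2,x_3,x_4,x_5},x_6,x_7\}$; - first $\mathcal J_{x_1,x_2,x_3,x_4,\{x_5,x_6,x_7\}}$, then $\{x_3,x_4,\mathcal J_{x_1,x_2,x_5,x_6,x_7}\}$, then $\mathcal J_{\{x_1,x_2,x_3\},x_4,x_5,x_6,x_7}+\mathcal J_{x_3,\{x_1,x_2,x_4\},x_5,x_6,x_7}+\mathcal J_{x_3,x_4,\{x_1,x_2,x_5\},x_6,x_7}+\mathcal J_{x_3,x_4,x_5,\{x_1,x_2,x_6\},x_7}+\mathcal J_{x_3,x_4,x_5,x_6,\{x_1,x_2,x_7\}}$. A *homomorphism* $F:L\to L'$ is a linear functor $(F_0,F_1)$ with a trilinear natural transformation $F_2(x,y,z):\{F_0x,F_0y,F_0z\}\to F_0\{x,y,z\}$ such that $F_2(x,x,y)=0$, $F_2(x,y,z)+F_2(y,z,x)+F_2(z,x,y)=0$, and the following two composites agree: - $\mathcal J_{F_0x_1,\dots,F_0x_5}$,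 then $\{F_2(x_1,x_2,x_3),F_0x_4,F_0x_5\}+\{F_0x_3,F_2(x_1,x_2,x_4),F_0x_5\}+\{F_0x_3,F_0x_4,F_2(x_1,x_2,x_5)\}$, then $F_2(\{x_1,x_2,x_3\},x_4,x_5)+F_2(x_3,\{x_1,x_2,x_4\},x_5)+F_2(x_3,x_4,\{x_1,x_2,x_5\})$; - $\{F_0x_1,F_0x_2,F_2(x_3,x_4,x_5)\}$, then $F_2(x_1,x_2,\{x_3,x_4,x_5\})$, then $F_1\mathcal J_{x_1,\dots,x_5}$. The composite of $F$ followed by $G$ is $(G_0F_0,G_1F_1)$ with $(GF)_2(x,y,z)$ equal to $G_2(F_0x,F_0y,F_0z)$ followed by $G_1F_2(x,y,z)$; the identity has $F_2(x,y,z)=1_{\{x,y,z\}}$. A *2-homomorphism* $\theta:F\Rightarrow G$ is a linear natural transformation such that $F_2(x,y,z)$ followed by $\theta_{\{x,y,z\}}$ equals $\{\theta_x,\theta_y,\theta_z\}$ followed by $G_2(x,y,z)$. Vertical and horizontal composition are those of natural transformations. **Theorem.** With these compositions, 2-term homotopy Lie triple systems, their homomorphisms and 2-homomorphisms form a (strict)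 2-category $\mathbf{2HLTS}$, and Lie triple 2-systems, their homomorphisms and 2-homomorphisms form a (strict) 2-category $\mathbf{LT2}$. There are strict 2-functors $T:\mathbf{2HLTS}\to\mathbf{LT2}$ and $S:\mathbf{LT2}\to\mathbf{2HLTS}$, given by the formulas below, and 2-natural isomorphisms $TS\cong 1_{\mathbf{LT2}}$ and $ST\cong 1_{\mathbf{2HLTS}}$. In particular the two 2-categories are 2-equivalent. - $T(\mathcal T)$ has objects $T_0$ and morphisms $T_0\oplus T_{-1}$ with $s(x,f)=x$, $t(x,f)=x+df$, $1_x=(x,0)$, $(x,f)$ followed by $(x+df,g)$ equal to $(x,f+g)$; the bracket on objects is that of $T_0$, on morphisms $$\{(x,f),(y,g),(z,h)\}=\bigl([x,y,z],\,[x,y,h]+[x,g,z]+[f,y,z]+[df,g,z]+[df,y,h]+[x,dg,h]+[df,dg,h]\bigr),$$ and $\mathcal J_{x_1,\dots,x_5}=([x_1,x_2,[x_3,x_4,x_5]],J(x_1,\dots,x_5))$. Further $T(\varphi)_0=\varphi_0$, $T(\varphi)_1=\varphi_0\oplus\varphi_1$, $T(\varphi)_2(x,y,z)=([\varphi_0x,\varphi_0y,\varphi_0z],\varphi_2(x,y,z))$,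 and $T(\tau)_x=(\varphi_0x,\tau x)$ for $\tau:\varphi\Rightarrow\psi$. - $S(L)$ has $T_0=L_0$, $T_{-1}=\ker s$, $d=t|_{\ker s}$, bracket $\{\cdot,\cdot,\cdot\}$ on $L_0$, $[f,x,y]=\{f,1_x,1_y\}$, $[x,f,y]=\{1_x,f,1_y\}$, $[x,y,f]=\{1_x,1_y,f\}$, and $J(x_1,\dots,x_5)=\mathcal J_{x_1,\dots,x_5}-1_{s(\mathcal J_{x_1,\dots,x_5})}$. Further $S(F)_0=F_0$, $S(F)_1=F_1|_{\ker s}$, $S(F)_2(x,y,z)=F_2(x,y,z)-1_{s(F_2(x,y,z))}$, and $S(\theta)(x)=\theta_x-1_{s(\theta_x)}$. -/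

import Mathlib

open CategoryTheory Bicategory

universe w u

namespace LieTriple

/-! ### Curried multilinear maps -/

section Multilinear

variable {k : Type*} [CommSemiring k] {A B C D E M : Type*}
  [AddCommMonoid A] [AddCommMonoid B] [AddCommMonoid C] [AddCommMonoid D] [AddCommMonoid E]
  [AddCommMonoid M]
  [Module k A] [Module k B] [Module k C] [Module k D] [Module k E] [Module k M]

/-- A function of three variables that is linear in each of them, as a curried linear map. -/
def trilin (f : A → B → C → M)
    (a₁ : ∀ x x' y z, f (x + x') y z = f x y z + f x' y z)
    (s₁ : ∀ (c : k) x y z, f (c • x) y z = c • f x y z)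
    (a₂ : ∀ x y y' z, f x (y + y') z = f x y z + f x y' z)
    (s₂ : ∀ (c : k) x y z, f x (c • y) z = c • f x y z)
    (a₃ : ∀ x y z z', f x y (z + z') = f x y z + f x y z')
    (s₃ : ∀ (c : k) x y z, f x y (c • z) = c • f x y z) :
    A →ₗ[k] B →ₗ[k] C →ₗ[k] M :=
  LinearMap.mk₂ k
    (fun x y => { toFun := f x y, map_add' := a₃ x y, map_smul' := fun c z => s₃ c x y z })
    (fun x x' y => LinearMap.ext fun z => a₁ x x' y z)
    (fun c x y => LinearMap.ext fun z => s₁ c x y z)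
    (fun x y y' => LinearMap.ext fun z => a₂ x y y' z)
    (fun c x y => LinearMap.ext fun z => s₂ c x y z)

@[simp] theorem trilin_apply (f : A → B → C → M) (a₁ s₁ a₂ s₂ a₃ s₃) (x : A) (y : B) (z : C) :
    trilin (k := k) f a₁ s₁ a₂ s₂ a₃ s₃ x y z = f x y z := rfl

/-- A function of five variables that is linear in each of them, as a curried linear map. -/
def pentalin (f : A → B → C → D → E → M)
    (a₁ : ∀ x x' y z v w, f (x + x') y z v w = f x y z v w + f x' y z v w)
    (s₁ : ∀ (c : k) x y z v w, f (c • x) y z v w = c • f x y z v w)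
    (a₂ : ∀ x y y' z v w, f x (y + y') z v w = f x y z v w + f x y' z v w)
    (s₂ : ∀ (c : k) x y z v w, f x (c • y) z v w = c • f x y z v w)
    (a₃ : ∀ x y z z' v w, f x y (z + z') v w = f x y z v w + f x y z' v w)
    (s₃ : ∀ (c : k) x y z v w, f x y (c • z) v w = c • f x y z v w)
    (a₄ : ∀ x y z v v' w, f x y z (v + v') w = f x y z v w + f x y z v' w)
    (s₄ : ∀ (c : k) x y z v w, f x y z (c • v) w = c • f x y z v w)
    (a₅ : ∀ x y z v w w', f x y z v (w + w') = f x y z v w + f x y z v w')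
    (s₅ : ∀ (c : k) x y z v w, f x y z v (c • w) = c • f x y z v w) :
    A →ₗ[k] B →ₗ[k] C →ₗ[k] D →ₗ[k] E →ₗ[k] M :=
  LinearMap.mk₂ k
    (fun x y => trilin (f x y) (a₃ x y) (fun c => s₃ c x y) (a₄ x y) (fun c => s₄ c x y)
      (a₅ x y) (fun c => s₅ c x y))
    (fun x x' y => by ext z v w; exact a₁ x x' y z v w)
    (fun c x y => by ext z v w; exact s₁ c x y z v w)
    (fun x y y' => by ext z v w; exact a₂ x y y' z v w)
    (fun c x y => by ext z v w; exact s₂ c x y z v w)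

@[simp] theorem pentalin_apply (f : A → B → C → D → E → M) (a₁ s₁ a₂ s₂ a₃ s₃ a₄ s₄ a₅ s₅)
    (x : A) (y : B) (z : C) (v : D) (w : E) :
    pentalin (k := k) f a₁ s₁ a₂ s₂ a₃ s₃ a₄ s₄ a₅ s₅ x y z v w = f x y z v w := rfl

end Multilinear

/-! ### 2-term homotopy Lie triple systems -/

/-- The data of a 2-term homotopy Lie triple system: a complex `d : X₁ → X₀` (with `X₀` in degree
`0` and `X₁` in degree `-1`), the components of degree `0` and `-1` of a trilinear bracket of
degree `0`, and a 5-linear map `J`. -/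
structure HLTSData (k : Type w) [Field k] where
  X₀ : Type u
  X₁ : Type u
  [grp₀ : AddCommGroup X₀]
  [grp₁ : AddCommGroup X₁]
  [mod₀ : Module k X₀]
  [mod₁ : Module k X₁]
  /-- the differential -/
  d : X₁ →ₗ[k] X₀
  /-- `[x, y, z]` -/
  br : X₀ →ₗ[k] X₀ →ₗ[k] X₀ →ₗ[k] X₀
  /-- `[f, x, y]` -/
  brL : X₁ →ₗ[k] X₀ →ₗ[k] X₀ →ₗ[k] X₁
  /-- `[x, f, y]` -/
  brM : X₀ →ₗ[k] X₁ →ₗ[k] X₀ →ₗ[k] X₁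
  /-- `[x, y, f]` -/
  brR : X₀ →ₗ[k] X₀ →ₗ[k] X₁ →ₗ[k] X₁
  J : X₀ →ₗ[k] X₀ →ₗ[k] X₀ →ₗ[k] X₀ →ₗ[k] X₀ →ₗ[k] X₁

attribute [instance] HLTSData.grp₀ HLTSData.grp₁ HLTSData.mod₀ HLTSData.mod₁

/-- A 2-term homotopy Lie triple system over the field `k`. -/
structure HLTS (k : Type w) [Field k] extends HLTSData.{w, u} k where
  d_brR : ∀ x y f, d (brR x y f) = br x y (d f)
  d_brM : ∀ x f y, d (brM x f y) = br x (d f) y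
  brM_d : ∀ f g x, brM (d f) g x = brL f (d g) x
  brR_d : ∀ f x g, brR (d f) x g = brL f x (d g)
  br_skew : ∀ x y z, br x y z = -br y x z
  brR_skew : ∀ x y f, brR x y f = -brR y x f
  brM_skew : ∀ x f y, brM x f y = -brL f x y
  br_cyc : ∀ x y z, br x y z + br y z x + br z x y = 0
  brR_cyc : ∀ x y f, brR x y f + brM y f x + brL f x y = 0
  J_alt : ∀ x₁ x₂ x y, J x₁ x₂ x x y = 0
  J_cyc : ∀ x₁ x₂ x y z, J x₁ x₂ x y z + J x₁ x₂ y z x + J x₁ x₂ z x y = 0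
  d_J : ∀ x₁ x₂ x₃ x₄ x₅, d (J x₁ x₂ x₃ x₄ x₅) =
    -br x₁ x₂ (br x₃ x₄ x₅) + br x₃ (br x₁ x₂ x₄) x₅ + br (br x₁ x₂ x₃) x₄ x₅
      + br x₃ x₄ (br x₁ x₂ x₅)
  J_d₁ : ∀ f x₂ x₃ x₄ x₅, J (d f) x₂ x₃ x₄ x₅ =
    -brL f x₂ (br x₃ x₄ x₅) + brM x₃ (brL f x₂ x₄) x₅ + brL (brL f x₂ x₃) x₄ x₅
      + brR x₃ x₄ (brL f x₂ x₅)
  J_d₂ : ∀ x₁ f x₃ x₄ x₅, J x₁ (d f) x₃ x₄ x₅ =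
    -brM x₁ f (br x₃ x₄ x₅) + brM x₃ (brM x₁ f x₄) x₅ + brL (brM x₁ f x₃) x₄ x₅
      + brR x₃ x₄ (brM x₁ f x₅)
  J_d₃ : ∀ x₁ x₂ f x₄ x₅, J x₁ x₂ (d f) x₄ x₅ =
    -brR x₁ x₂ (brL f x₄ x₅) + brL f (br x₁ x₂ x₄) x₅ + brL (brR x₁ x₂ f) x₄ x₅
      + brL f x₄ (br x₁ x₂ x₅)
  J_d₅ : ∀ x₁ x₂ x₃ x₄ f, J x₁ x₂ x₃ x₄ (d f) =
    -brR x₁ x₂ (brR x₃ x₄ f) + brR x₃ (br x₁ x₂ x₄) f + brR (br x₁ x₂ x₃) x₄ f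
      + brR x₃ x₄ (brR x₁ x₂ f)
  J_coh : ∀ x₁ x₂ x₃ x₄ x₅ x₆ x₇,
    brL (J x₁ x₂ x₃ x₄ x₅) x₆ x₇ + brM x₅ (J x₁ x₂ x₃ x₄ x₆) x₇ + brR x₁ x₂ (J x₃ x₄ x₅ x₆ x₇)
      + brR x₅ x₆ (J x₁ x₂ x₃ x₄ x₇) + J x₁ x₂ (br x₃ x₄ x₅) x₆ x₇ + J x₁ x₂ x₅ (br x₃ x₄ x₆) x₇
      + J x₁ x₂ x₅ x₆ (br x₃ x₄ x₇) =
    brR x₃ x₄ (J x₁ x₂ x₅ x₆ x₇) + J (br x₁ x₂ x₃) x₄ x₅ x₆ x₇ + J x₃ (br x₁ x₂ x₄) x₅ x₆ x₇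
      + J x₃ x₄ (br x₁ x₂ x₅) x₆ x₇ + J x₃ x₄ x₅ (br x₁ x₂ x₆) x₇
      + J x₁ x₂ x₃ x₄ (br x₅ x₆ x₇) + J x₃ x₄ x₅ x₆ (br x₁ x₂ x₇)

namespace HLTS

variable {k : Type w} [Field k]

/-- The data of a homomorphism of 2-term homotopy Lie triple systems. -/
@[ext] structure HomData (A B : HLTSData.{w, u} k) where
  φ₀ : A.X₀ →ₗ[k] B.X₀
  φ₁ : A.X₁ →ₗ[k] B.X₁
  φ₂ : A.X₀ →ₗ[k] A.X₀ →ₗ[k] A.X₀ →ₗ[k] B.X₁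

/-- A homomorphism of 2-term homotopy Lie triple systems. -/
@[ext] structure Hom (A B : HLTS.{w, u} k) extends HomData A.toHLTSData B.toHLTSData where
  chain : ∀ h, φ₀ (A.d h) = B.d (φ₁ h)
  alt : ∀ x y, φ₂ x x y = 0
  cyc : ∀ x y z, φ₂ x y z = -φ₂ y z x - φ₂ z x y
  d_φ₂ : ∀ x y z, B.d (φ₂ x y z) = φ₀ (A.br x y z) - B.br (φ₀ x) (φ₀ y) (φ₀ z)
  φ₂_R : ∀ x y h, φ₂ x y (A.d h) = φ₁ (A.brR x y h) - B.brR (φ₀ x) (φ₀ y) (φ₁ h)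
  φ₂_M : ∀ x h y, φ₂ x (A.d h) y = φ₁ (A.brM x h y) - B.brM (φ₀ x) (φ₁ h) (φ₀ y)
  coh : ∀ x₁ x₂ x₃ x₄ x₅,
    B.J (φ₀ x₁) (φ₀ x₂) (φ₀ x₃) (φ₀ x₄) (φ₀ x₅) + B.brL (φ₂ x₁ x₂ x₃) (φ₀ x₄) (φ₀ x₅)
      + B.brM (φ₀ x₃) (φ₂ x₁ x₂ x₄) (φ₀ x₅) + B.brR (φ₀ x₃) (φ₀ x₄) (φ₂ x₁ x₂ x₅)
      + φ₂ (A.br x₁ x₂ x₃) x₄ x₅ + φ₂ x₃ (A.br x₁ x₂ x₄) x₅ + φ₂ x₃ x₄ (A.br x₁ x₂ x₅) =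
    B.brR (φ₀ x₁) (φ₀ x₂) (φ₂ x₃ x₄ x₅) + φ₂ x₁ x₂ (A.br x₃ x₄ x₅) + φ₁ (A.J x₁ x₂ x₃ x₄ x₅)

/-- A 2-homomorphism `φ ⇒ ψ`: a chain homotopy `τ` from `φ` to `ψ`, compatible with `φ₂`, `ψ₂`. -/
@[ext] structure TwoHom {A B : HLTS.{w, u} k} (φ ψ : Hom A B) where
  τ : A.X₀ →ₗ[k] B.X₁
  d_τ : ∀ x, B.d (τ x) = ψ.φ₀ x - φ.φ₀ x
  τ_d : ∀ h, τ (A.d h) = ψ.φ₁ h - φ.φ₁ h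
  coh : ∀ x y z, φ.φ₂ x y z - ψ.φ₂ x y z =
    B.brR (φ.φ₀ x) (φ.φ₀ y) (τ z) + B.brM (φ.φ₀ x) (τ y) (φ.φ₀ z) + B.brL (τ x) (φ.φ₀ y) (φ.φ₀ z)
      + B.brM (B.d (τ x)) (τ y) (φ.φ₀ z) + B.brR (B.d (τ x)) (φ.φ₀ y) (τ z)
      + B.brR (φ.φ₀ x) (B.d (τ y)) (τ z)
      + B.brR (B.d (τ x)) (B.d (τ y)) (τ z)
      - τ (A.br x y z)

section Lemmas

variable (A : HLTS.{w, u} k)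

theorem d_brL (f x y) : A.d (A.brL f x y) = A.br (A.d f) x y := by
  have h := A.brM_skew x f y
  rw [← neg_eq_iff_eq_neg] at h
  rw [← h, map_neg, A.d_brM, A.br_skew (A.d f)]

theorem brM_dR (x f g) : A.brM x f (A.d g) = A.brR x (A.d f) g := by
  rw [A.brM_skew, ← A.brR_d, A.brR_skew, neg_neg]

variable {A} {B : HLTS.{w, u} k}

theorem Hom.skew (φ : Hom A B) (x y z) : φ.φ₂ x y z = -φ.φ₂ y x z := by
  have h := φ.alt (x + y) z
  simp only [map_add, LinearMap.add_apply, φ.alt, zero_add, add_zero] at h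
  exact eq_neg_of_add_eq_zero_right h

theorem Hom.φ₂_L (φ : Hom A B) (h x y) :
    φ.φ₂ (A.d h) x y = φ.φ₁ (A.brL h x y) - B.brL (φ.φ₁ h) (φ.φ₀ x) (φ.φ₀ y) := by
  rw [φ.skew, φ.φ₂_M, A.brM_skew, B.brM_skew, map_neg]
  abel

end Lemmas

/-- The identity homomorphism. -/
def Hom.id (A : HLTS.{w, u} k) : Hom A A where
  φ₀ := LinearMap.id
  φ₁ := LinearMap.id
  φ₂ := 0
  chain _ := rfl
  alt := by simp
  cyc := by simp
  d_φ₂ := by simp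
  φ₂_R := by simp
  φ₂_M := by simp
  coh := by simp

/-- The composite of `φ` followed by `ψ`. -/
def Hom.comp {A B C : HLTS.{w, u} k} (φ : Hom A B) (ψ : Hom B C) : Hom A C where
  φ₀ := ψ.φ₀ ∘ₗ φ.φ₀
  φ₁ := ψ.φ₁ ∘ₗ φ.φ₁
  φ₂ := trilin (fun x y z => ψ.φ₂ (φ.φ₀ x) (φ.φ₀ y) (φ.φ₀ z) + ψ.φ₁ (φ.φ₂ x y z))
    (by intros; simp; abel) (by intros; simp)
    (by intros; simp; abel) (by intros; simp) (by intros; simp; abel) (by intros; simp)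
  chain h := by simp [φ.chain, ψ.chain]
  alt := by simp [φ.alt, ψ.alt]
  cyc x y z := by
    simp only [trilin_apply]
    rw [φ.cyc x y z, ψ.cyc (φ.φ₀ x) (φ.φ₀ y) (φ.φ₀ z)]
    simp only [map_sub, map_neg]
    abel
  d_φ₂ x y z := by
    simp only [trilin_apply, map_add, ψ.d_φ₂, ← ψ.chain, φ.d_φ₂, map_sub, LinearMap.comp_apply]
    abel
  φ₂_R x y h := by
    simp only [trilin_apply, φ.chain, ψ.φ₂_R, φ.φ₂_R, map_sub, LinearMap.comp_apply]
    abel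
  φ₂_M x h y := by
    simp only [trilin_apply, φ.chain, ψ.φ₂_M, φ.φ₂_M, map_sub, LinearMap.comp_apply]
    abel
  coh x₁ x₂ x₃ x₄ x₅ := by
    have hφ := congrArg ψ.φ₁ (φ.coh x₁ x₂ x₃ x₄ x₅)
    have hψ := ψ.coh (φ.φ₀ x₁) (φ.φ₀ x₂) (φ.φ₀ x₃) (φ.φ₀ x₄) (φ.φ₀ x₅)
    have h₁ := ψ.φ₂_L (φ.φ₂ x₁ x₂ x₃) (φ.φ₀ x₄) (φ.φ₀ x₅)
    have h₂ := ψ.φ₂_M (φ.φ₀ x₃) (φ.φ₂ x₁ x₂ x₄) (φ.φ₀ x₅)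
    have h₃ := ψ.φ₂_R (φ.φ₀ x₃) (φ.φ₀ x₄) (φ.φ₂ x₁ x₂ x₅)
    have h₄ := ψ.φ₂_R (φ.φ₀ x₁) (φ.φ₀ x₂) (φ.φ₂ x₃ x₄ x₅)
    simp only [trilin_apply, map_add, map_sub, LinearMap.add_apply, LinearMap.sub_apply,
      φ.d_φ₂, LinearMap.comp_apply] at *
    linear_combination (norm := abel) hφ + hψ + h₁ + h₂ + h₃ - h₄

/-- The identity 2-homomorphism. -/
def TwoHom.id {A B : HLTS.{w, u} k} (φ : Hom A B) : TwoHom φ φ where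
  τ := 0
  d_τ := by simp
  τ_d := by simp
  coh := by simp

/-- Vertical composition of 2-homomorphisms. -/
def TwoHom.vcomp {A B : HLTS.{w, u} k} {φ ψ χ : Hom A B} (σ : TwoHom φ ψ) (τ : TwoHom ψ χ) :
    TwoHom φ χ where
  τ := σ.τ + τ.τ
  d_τ x := by simp [σ.d_τ, τ.d_τ]
  τ_d h := by simp [σ.τ_d, τ.τ_d]
  coh x y z := by
    have hψ : ∀ x, ψ.φ₀ x = φ.φ₀ x + B.d (σ.τ x) := fun x => by rw [σ.d_τ]; abel
    have h₁ := σ.coh x y z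
    have h₂ := τ.coh x y z
    simp only [hψ, map_add, LinearMap.add_apply, B.brM_d, B.brM_dR, B.brR_d] at h₁ h₂ ⊢
    linear_combination (norm := abel) h₁ + h₂

/-- Whiskering `φ` followed by `σ`. -/
def TwoHom.whiskerLeft {A B C : HLTS.{w, u} k} (φ : Hom A B) {ψ χ : Hom B C} (σ : TwoHom ψ χ) :
    TwoHom (φ.comp ψ) (φ.comp χ) where
  τ := σ.τ ∘ₗ φ.φ₀
  d_τ x := by simp [σ.d_τ, Hom.comp]
  τ_d h := by simp [σ.τ_d, Hom.comp, φ.chain]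
  coh x y z := by
    have h₁ := σ.coh (φ.φ₀ x) (φ.φ₀ y) (φ.φ₀ z)
    have h₂ := σ.τ_d (φ.φ₂ x y z)
    simp only [Hom.comp, trilin_apply, LinearMap.comp_apply, φ.d_φ₂, map_sub] at *
    linear_combination (norm := abel) h₁ + h₂

/-- Whiskering `σ` followed by `χ`. -/
def TwoHom.whiskerRight {A B C : HLTS.{w, u} k} {φ ψ : Hom A B} (σ : TwoHom φ ψ) (χ : Hom B C) :
    TwoHom (φ.comp χ) (ψ.comp χ) where
  τ := χ.φ₁ ∘ₗ σ.τ
  d_τ x := by simp [σ.d_τ, Hom.comp, ← χ.chain]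
  τ_d h := by simp [σ.τ_d, Hom.comp]
  coh x y z := by
    have hψ : ∀ x, ψ.φ₀ x = φ.φ₀ x + B.d (σ.τ x) := fun x => by rw [σ.d_τ]; abel
    have h₁ := congrArg χ.φ₁ (σ.coh x y z)
    simp only [Hom.comp, trilin_apply, LinearMap.comp_apply, map_sub, map_add,
      LinearMap.add_apply, hψ, χ.φ₂_L, χ.φ₂_M, χ.φ₂_R, χ.chain, B.brM_d, B.brM_dR, B.brR_d,
      C.brM_d, C.brM_dR, C.brR_d] at h₁ ⊢
    linear_combination (norm := abel) h₁

instance (A B : HLTS.{w, u} k) : Category (Hom A B) where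
  Hom := TwoHom
  id := TwoHom.id
  comp := TwoHom.vcomp
  id_comp σ := TwoHom.ext (by simp [TwoHom.vcomp, TwoHom.id])
  comp_id σ := TwoHom.ext (by simp [TwoHom.vcomp, TwoHom.id])
  assoc σ τ υ := TwoHom.ext (by simp [TwoHom.vcomp, add_assoc])


theorem Hom.ext_data {A B : HLTS.{w, u} k} {φ ψ : Hom A B} (h : φ.toHomData = ψ.toHomData) :
    φ = ψ := by
  cases φ; cases ψ; cases h; rfl

theorem Hom.id_comp {A B : HLTS.{w, u} k} (φ : Hom A B) : (Hom.id A).comp φ = φ :=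
  Hom.ext_data (HomData.ext rfl rfl (by ext; simp [Hom.comp, Hom.id]))

theorem Hom.comp_id {A B : HLTS.{w, u} k} (φ : Hom A B) : φ.comp (Hom.id B) = φ :=
  Hom.ext_data (HomData.ext rfl rfl (by ext; simp [Hom.comp, Hom.id]))

theorem Hom.assoc {A B C D : HLTS.{w, u} k} (φ : Hom A B) (ψ : Hom B C) (χ : Hom C D) :
    (φ.comp ψ).comp χ = φ.comp (ψ.comp χ) :=
  Hom.ext_data (HomData.ext rfl rfl (by ext; simp [Hom.comp, add_assoc]))

theorem id_τ {A B : HLTS.{w, u} k} (φ : Hom A B) : TwoHom.τ (𝟙 φ) = 0 := rfl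

theorem comp_τ {A B : HLTS.{w, u} k} {φ ψ χ : Hom A B} (σ : φ ⟶ ψ) (τ : ψ ⟶ χ) :
    TwoHom.τ (σ ≫ τ) = TwoHom.τ σ + TwoHom.τ τ := rfl

theorem eqToHom_τ {A B : HLTS.{w, u} k} {φ ψ : Hom A B} (h : φ = ψ) :
    TwoHom.τ (eqToHom h) = 0 := by
  subst h; rfl

theorem twoHom_ext {A B : HLTS.{w, u} k} {φ ψ : Hom A B} {σ τ : φ ⟶ ψ}
    (h : TwoHom.τ σ = TwoHom.τ τ) : σ = τ :=
  TwoHom.ext h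

/-- The invertible 2-homomorphism between equal homomorphisms, given by the zero homotopy. -/
def zeroIso {A B : HLTS.{w, u} k} {φ ψ : Hom A B} (h : φ = ψ) : φ ≅ ψ where
  hom := { τ := 0, d_τ := by simp [h], τ_d := by simp [h], coh := by simp [h] }
  inv := { τ := 0, d_τ := by simp [h], τ_d := by simp [h], coh := by simp [h] }
  hom_inv_id := twoHom_ext (add_zero (0 : A.X₀ →ₗ[k] B.X₁))
  inv_hom_id := twoHom_ext (add_zero (0 : A.X₀ →ₗ[k] B.X₁))

theorem zeroIso_eq {A B : HLTS.{w, u} k} {φ ψ : Hom A B} (h : φ = ψ) : zeroIso h = eqToIso h := by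
  ext : 1
  exact twoHom_ext (eqToHom_τ h).symm

/-- The 2-category of 2-term homotopy Lie triple systems. -/
instance : Bicategory (HLTS.{w, u} k) where
  Hom := Hom
  id := Hom.id
  comp := Hom.comp
  homCategory := inferInstance
  whiskerLeft φ _ _ σ := TwoHom.whiskerLeft φ σ
  whiskerRight σ χ := TwoHom.whiskerRight σ χ
  associator φ ψ χ := zeroIso (Hom.assoc φ ψ χ)
  leftUnitor φ := zeroIso (Hom.id_comp φ)
  rightUnitor φ := zeroIso (Hom.comp_id φ)
  whiskerLeft_id _ _ := twoHom_ext rfl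
  whiskerLeft_comp _ _ _ _ _ _ := twoHom_ext rfl
  id_whiskerLeft σ := twoHom_ext (by simp : σ.τ = 0 + (σ.τ + 0))
  comp_whiskerLeft φ ψ _ _ σ := twoHom_ext
    (by simp : σ.τ ∘ₗ ψ.φ₀ ∘ₗ φ.φ₀ = 0 + (σ.τ ∘ₗ ψ.φ₀ ∘ₗ φ.φ₀ + 0))
  id_whiskerRight _ ψ := twoHom_ext (LinearMap.comp_zero ψ.φ₁)
  comp_whiskerRight σ τ χ := twoHom_ext (LinearMap.comp_add σ.τ τ.τ χ.φ₁)
  whiskerRight_id σ := twoHom_ext (by simp : σ.τ = 0 + (σ.τ + 0))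
  whiskerRight_comp σ ψ χ := twoHom_ext
    (by simp : χ.φ₁ ∘ₗ ψ.φ₁ ∘ₗ σ.τ = 0 + (χ.φ₁ ∘ₗ ψ.φ₁ ∘ₗ σ.τ + 0))
  whisker_assoc φ _ _ σ χ := twoHom_ext
    (by simp : χ.φ₁ ∘ₗ σ.τ ∘ₗ φ.φ₀ = 0 + (χ.φ₁ ∘ₗ σ.τ ∘ₗ φ.φ₀ + 0))
  whisker_exchange {A B C φ ψ χ ω} σ τ := by
    apply twoHom_ext
    ext x
    have h := TwoHom.τ_d τ (TwoHom.τ σ x)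
    rw [TwoHom.d_τ σ, map_sub] at h
    simp only [comp_τ, TwoHom.whiskerRight, TwoHom.whiskerLeft, LinearMap.add_apply,
      LinearMap.comp_apply]
    linear_combination (norm := abel) -h
  pentagon {A B C D E} φ ψ χ ω := twoHom_ext
    (by simp : ω.φ₁ ∘ₗ (0 : A.X₀ →ₗ[k] D.X₁) + (0 + (0 : B.X₀ →ₗ[k] E.X₁) ∘ₗ φ.φ₀) = 0 + 0)
  triangle {A B C} φ ψ := twoHom_ext
    (by simp : 0 + (0 : B.X₀ →ₗ[k] C.X₁) ∘ₗ φ.φ₀ = ψ.φ₁ ∘ₗ (0 : A.X₀ →ₗ[k] B.X₁))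

instance : Bicategory.Strict (HLTS.{w, u} k) where
  id_comp := Hom.id_comp
  comp_id := Hom.comp_id
  assoc := Hom.assoc
  leftUnitor_eqToIso _ := zeroIso_eq _
  rightUnitor_eqToIso _ := zeroIso_eq _
  associator_eqToIso _ _ _ := zeroIso_eq _

end HLTS

/-! ### 2-vector spaces -/

/-- The space of composable pairs of arrows, for given source and target maps. -/
def composable {k M O : Type*} [Field k] [AddCommGroup M] [AddCommGroup O] [Module k M]
    [Module k O] (s t : M →ₗ[k] O) : Submodule k (M × M) :=
  LinearMap.eqLocus (t ∘ₗ LinearMap.fst k M M) (s ∘ₗ LinearMap.snd k M M)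

/-- A 2-vector space: a category internal to vector spaces over `k`. -/
structure TwoVect (k : Type w) [Field k] where
  /-- objects -/
  Ob : Type u
  /-- morphisms -/
  Mor : Type u
  [grpOb : AddCommGroup Ob]
  [grpMor : AddCommGroup Mor]
  [modOb : Module k Ob]
  [modMor : Module k Mor]
  /-- source -/
  s : Mor →ₗ[k] Ob
  /-- target -/
  t : Mor →ₗ[k] Ob
  /-- identities -/
  one : Ob →ₗ[k] Mor
  /-- composition of `f` followed by `g`, for `t f = s g` -/
  comp : composable s t →ₗ[k] Mor
  s_one : ∀ x, s (one x) = x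
  t_one : ∀ x, t (one x) = x
  s_comp : ∀ (f g : Mor) (h : t f = s g), s (comp ⟨(f, g), h⟩) = s f
  t_comp : ∀ (f g : Mor) (h : t f = s g), t (comp ⟨(f, g), h⟩) = t g
  one_comp : ∀ f, comp ⟨(one (s f), f), t_one (s f)⟩ = f
  comp_one : ∀ f, comp ⟨(f, one (t f)), (s_one (t f)).symm⟩ = f
  assoc : ∀ (f g h : Mor) (hfg : t f = s g) (hgh : t g = s h),
    comp ⟨(comp ⟨(f, g), hfg⟩, h), (t_comp f g hfg).trans hgh⟩ =
      comp ⟨(f, comp ⟨(g, h), hgh⟩), hfg.trans (s_comp g h hgh).symm⟩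

attribute [instance] TwoVect.grpOb TwoVect.grpMor TwoVect.modOb TwoVect.modMor

namespace TwoVect

variable {k : Type w} [Field k] (V : TwoVect.{w, u} k)

/-- The composite of `f` followed by `g`. -/
def cmp (f g : V.Mor) (h : V.t f = V.s g) : V.Mor := V.comp ⟨(f, g), h⟩

/-- `m` is the composite of the given nonempty path of composable morphisms, first arrow first. -/
def IsComposite : List V.Mor → V.Mor → Prop
  | [], _ => False
  | [f], m => f = m
  | f :: g :: l, m => ∃ n, IsComposite (g :: l) n ∧ ∃ h : V.t f = V.s n, V.cmp f n h = m

/-- Both paths are composable and they have the same composite. -/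
def Commutes (p q : List V.Mor) : Prop := ∃ m, V.IsComposite p m ∧ V.IsComposite q m

/-- `f` is an isomorphism. -/
def IsIso (f : V.Mor) : Prop :=
  ∃ g, V.Commutes [f, g] [V.one (V.s f)] ∧ V.Commutes [g, f] [V.one (V.t f)]

/-- The composition is determined by the remaining structure. -/
theorem cmp_eq (f g : V.Mor) (h : V.t f = V.s g) : V.cmp f g h = f + g - V.one (V.t f) := by
  have e : V.s (g - V.one (V.t f)) = 0 := by rw [map_sub, V.s_one, h, sub_self]
  have h₂ := V.one_comp (g - V.one (V.t f))
  have key : (⟨(f, g), h⟩ : composable V.s V.t) =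
      ⟨(f, V.one (V.t f)), (V.s_one (V.t f)).symm⟩ +
      ⟨(V.one (V.s (g - V.one (V.t f))), g - V.one (V.t f)), V.t_one _⟩ := by
    apply Subtype.ext
    simp [e]
  rw [cmp, key, map_add, V.comp_one, h₂]
  abel

theorem isComposite_two (f g m : V.Mor) :
    V.IsComposite [f, g] m ↔ V.t f = V.s g ∧ f + g - V.one (V.t f) = m := by
  simp [IsComposite, cmp_eq]

theorem isComposite_three (f g h m : V.Mor) : V.IsComposite [f, g, h] m ↔
    V.t f = V.s g ∧ V.t g = V.s h ∧ f + (g + h - V.one (V.t g)) - V.one (V.t f) = m := by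
  rw [IsComposite]
  simp only [isComposite_two, cmp_eq, exists_prop]
  constructor
  · rintro ⟨_, ⟨h₁, rfl⟩, h₂, rfl⟩
    refine ⟨?_, h₁, rfl⟩
    simpa [V.s_one, h₁] using h₂
  · rintro ⟨h₁, h₂, rfl⟩
    exact ⟨_, ⟨h₂, rfl⟩, by simp [V.s_one, h₁, h₂], rfl⟩

theorem commutes₂₁ (f g h : V.Mor) :
    V.Commutes [f, g] [h] ↔ V.t f = V.s g ∧ f + g - V.one (V.t f) = h := by
  simp [Commutes, IsComposite, cmp_eq]

theorem commutes₂₂ (f g f' g' : V.Mor) : V.Commutes [f, g] [f', g'] ↔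
    V.t f = V.s g ∧ V.t f' = V.s g' ∧ f + g - V.one (V.t f) = f' + g' - V.one (V.t f') := by
  simp only [Commutes, isComposite_two]
  constructor
  · rintro ⟨m, ⟨h₁, h₂⟩, h₃, h₄⟩
    exact ⟨h₁, h₃, h₂.trans h₄.symm⟩
  · rintro ⟨h₁, h₂, h₃⟩
    exact ⟨_, ⟨h₁, rfl⟩, h₂, h₃.symm⟩

theorem commutes₃₃ (f g h f' g' h' : V.Mor) : V.Commutes [f, g, h] [f', g', h'] ↔
    (V.t f = V.s g ∧ V.t g = V.s h) ∧ (V.t f' = V.s g' ∧ V.t g' = V.s h') ∧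
      f + (g + h - V.one (V.t g)) - V.one (V.t f) =
        f' + (g' + h' - V.one (V.t g')) - V.one (V.t f') := by
  simp only [Commutes, isComposite_three]
  constructor
  · rintro ⟨m, ⟨h₁, h₁', h₂⟩, h₃, h₃', h₄⟩
    exact ⟨⟨h₁, h₁'⟩, ⟨h₃, h₃'⟩, h₂.trans h₄.symm⟩
  · rintro ⟨⟨h₁, h₁'⟩, ⟨h₂, h₂'⟩, h₃⟩
    exact ⟨_, ⟨h₁, h₁', rfl⟩, h₂, h₂', h₃.symm⟩

/-- Every morphism of a 2-vector space is invertible. -/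
theorem isIso (f : V.Mor) : V.IsIso f := by
  refine ⟨V.one (V.s f) + V.one (V.t f) - f, ?_, ?_⟩ <;> rw [commutes₂₁] <;>
    simp [V.s_one, V.t_one]

end TwoVect

/-! ### Lie triple 2-systems -/

/-- The data of a Lie triple 2-system: a 2-vector space, a trilinear bracket on objects and on
morphisms, and the fundamentor. -/
structure LT2Data (k : Type w) [Field k] extends TwoVect.{w, u} k where
  br₀ : Ob →ₗ[k] Ob →ₗ[k] Ob →ₗ[k] Ob
  br₁ : Mor →ₗ[k] Mor →ₗ[k] Mor →ₗ[k] Mor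
  Jac : Ob →ₗ[k] Ob →ₗ[k] Ob →ₗ[k] Ob →ₗ[k] Ob →ₗ[k] Mor

/-- A Lie triple 2-system over the field `k`. -/
structure LT2 (k : Type w) [Field k] extends LT2Data.{w, u} k where
  -- the bracket is a functor
  s_br : ∀ f g h, s (br₁ f g h) = br₀ (s f) (s g) (s h)
  t_br : ∀ f g h, t (br₁ f g h) = br₀ (t f) (t g) (t h)
  br_one : ∀ x y z, br₁ (one x) (one y) (one z) = one (br₀ x y z)
  br_comp : ∀ (f f' g g' h h' : Mor) (hf : t f = s f') (hg : t g = s g') (hh : t h = s h'),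
    toTwoVect.Commutes [br₁ f g h, br₁ f' g' h']
      [br₁ (toTwoVect.cmp f f' hf) (toTwoVect.cmp g g' hg) (toTwoVect.cmp h h' hh)]
  -- its symmetries, on objects and on morphisms
  br₀_alt : ∀ x y, br₀ x x y = 0
  br₀_cyc : ∀ x y z, br₀ x y z + br₀ y z x + br₀ z x y = 0
  br₁_alt : ∀ f g, br₁ f f g = 0
  br₁_cyc : ∀ f g h, br₁ f g h + br₁ g h f + br₁ h f g = 0
  -- the fundamentor is a natural isomorphism
  s_Jac : ∀ x₁ x₂ x₃ x₄ x₅, s (Jac x₁ x₂ x₃ x₄ x₅) = br₀ x₁ x₂ (br₀ x₃ x₄ x₅)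
  t_Jac : ∀ x₁ x₂ x₃ x₄ x₅, t (Jac x₁ x₂ x₃ x₄ x₅) =
    br₀ (br₀ x₁ x₂ x₃) x₄ x₅ + br₀ x₃ (br₀ x₁ x₂ x₄) x₅ + br₀ x₃ x₄ (br₀ x₁ x₂ x₅)
  Jac_iso : ∀ x₁ x₂ x₃ x₄ x₅, toTwoVect.IsIso (Jac x₁ x₂ x₃ x₄ x₅)
  Jac_nat : ∀ f₁ f₂ f₃ f₄ f₅ : Mor, toTwoVect.Commutes
    [br₁ f₁ f₂ (br₁ f₃ f₄ f₅), Jac (t f₁) (t f₂) (t f₃) (t f₄) (t f₅)]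
    [Jac (s f₁) (s f₂) (s f₃) (s f₄) (s f₅),
      br₁ (br₁ f₁ f₂ f₃) f₄ f₅ + br₁ f₃ (br₁ f₁ f₂ f₄) f₅ + br₁ f₃ f₄ (br₁ f₁ f₂ f₅)]
  -- it has the symmetries of the bracket in its last three arguments
  Jac_alt : ∀ x₁ x₂ x y, Jac x₁ x₂ x x y = 0
  Jac_cyc : ∀ x₁ x₂ x y z, Jac x₁ x₂ x y z + Jac x₁ x₂ y z x + Jac x₁ x₂ z x y = 0
  -- the fundamental identity; `one` of a sum is the identity on the summands that do not change
  Jac_coh : ∀ x₁ x₂ x₃ x₄ x₅ x₆ x₇, toTwoVect.Commutes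
    [br₁ (one x₁) (one x₂) (Jac x₃ x₄ x₅ x₆ x₇),
     Jac x₁ x₂ (br₀ x₃ x₄ x₅) x₆ x₇ + Jac x₁ x₂ x₅ (br₀ x₃ x₄ x₆) x₇
      + Jac x₁ x₂ x₅ x₆ (br₀ x₃ x₄ x₇),
     br₁ (one x₅) (one x₆) (Jac x₁ x₂ x₃ x₄ x₇)
      + one (br₀ (br₀ x₁ x₂ (br₀ x₃ x₄ x₅)) x₆ x₇ + br₀ (br₀ x₃ x₄ x₅) (br₀ x₁ x₂ x₆) x₇
        + br₀ (br₀ x₃ x₄ x₅) x₆ (br₀ x₁ x₂ x₇) + br₀ (br₀ x₁ x₂ x₅) (br₀ x₃ x₄ x₆) x₇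
        + br₀ x₅ (br₀ x₁ x₂ (br₀ x₃ x₄ x₆)) x₇ + br₀ x₅ (br₀ x₃ x₄ x₆) (br₀ x₁ x₂ x₇)
        + br₀ (br₀ x₁ x₂ x₅) x₆ (br₀ x₃ x₄ x₇) + br₀ x₅ (br₀ x₁ x₂ x₆) (br₀ x₃ x₄ x₇)),
     br₁ (one x₅) (Jac x₁ x₂ x₃ x₄ x₆) (one x₇) + br₁ (Jac x₁ x₂ x₃ x₄ x₅) (one x₆) (one x₇)
      + one (br₀ (br₀ x₃ x₄ x₅) (br₀ x₁ x₂ x₆) x₇ + br₀ (br₀ x₃ x₄ x₅) x₆ (br₀ x₁ x₂ x₇)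
        + br₀ (br₀ x₁ x₂ x₅) (br₀ x₃ x₄ x₆) x₇ + br₀ x₅ (br₀ x₃ x₄ x₆) (br₀ x₁ x₂ x₇)
        + br₀ (br₀ x₁ x₂ x₅) x₆ (br₀ x₃ x₄ x₇) + br₀ x₅ (br₀ x₁ x₂ x₆) (br₀ x₃ x₄ x₇)
        + br₀ x₅ x₆ (br₀ (br₀ x₁ x₂ x₃) x₄ x₇) + br₀ x₅ x₆ (br₀ x₃ (br₀ x₁ x₂ x₄) x₇)
        + br₀ x₅ x₆ (br₀ x₃ x₄ (br₀ x₁ x₂ x₇)))]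
    [Jac x₁ x₂ x₃ x₄ (br₀ x₅ x₆ x₇),
     br₁ (one x₃) (one x₄) (Jac x₁ x₂ x₅ x₆ x₇)
      + one (br₀ (br₀ x₁ x₂ x₃) x₄ (br₀ x₅ x₆ x₇) + br₀ x₃ (br₀ x₁ x₂ x₄) (br₀ x₅ x₆ x₇)),
     Jac (br₀ x₁ x₂ x₃) x₄ x₅ x₆ x₇ + Jac x₃ (br₀ x₁ x₂ x₄) x₅ x₆ x₇
      + Jac x₃ x₄ (br₀ x₁ x₂ x₅) x₆ x₇ + Jac x₃ x₄ x₅ (br₀ x₁ x₂ x₆) x₇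
      + Jac x₃ x₄ x₅ x₆ (br₀ x₁ x₂ x₇)]

namespace LT2

variable {k : Type w} [Field k]

/-- The data of a homomorphism of Lie triple 2-systems. -/
@[ext] structure HomData (A B : LT2Data.{w, u} k) where
  F₀ : A.Ob →ₗ[k] B.Ob
  F₁ : A.Mor →ₗ[k] B.Mor
  F₂ : A.Ob →ₗ[k] A.Ob →ₗ[k] A.Ob →ₗ[k] B.Mor

/-- A homomorphism of Lie triple 2-systems. -/
structure Hom (A B : LT2.{w, u} k) extends HomData A.toLT2Data B.toLT2Data where
  -- `(F₀, F₁)` is a functor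
  s_F₁ : ∀ f, B.s (F₁ f) = F₀ (A.s f)
  t_F₁ : ∀ f, B.t (F₁ f) = F₀ (A.t f)
  F₁_one : ∀ x, F₁ (A.one x) = B.one (F₀ x)
  F₁_comp : ∀ (f g : A.Mor) (h : A.t f = A.s g), B.Commutes [F₁ f, F₁ g] [F₁ (A.cmp f g h)]
  -- `F₂` is a natural transformation
  s_F₂ : ∀ x y z, B.s (F₂ x y z) = B.br₀ (F₀ x) (F₀ y) (F₀ z)
  t_F₂ : ∀ x y z, B.t (F₂ x y z) = F₀ (A.br₀ x y z)
  F₂_nat : ∀ f g h, B.Commutes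
    [B.br₁ (F₁ f) (F₁ g) (F₁ h), F₂ (A.t f) (A.t g) (A.t h)]
    [F₂ (A.s f) (A.s g) (A.s h), F₁ (A.br₁ f g h)]
  alt : ∀ x y, F₂ x x y = 0
  cyc : ∀ x y z, F₂ x y z = -F₂ y z x - F₂ z x y
  coh : ∀ x₁ x₂ x₃ x₄ x₅, B.Commutes
    [B.Jac (F₀ x₁) (F₀ x₂) (F₀ x₃) (F₀ x₄) (F₀ x₅),
     B.br₁ (F₂ x₁ x₂ x₃) (B.one (F₀ x₄)) (B.one (F₀ x₅))
      + B.br₁ (B.one (F₀ x₃)) (F₂ x₁ x₂ x₄) (B.one (F₀ x₅))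
      + B.br₁ (B.one (F₀ x₃)) (B.one (F₀ x₄)) (F₂ x₁ x₂ x₅),
     F₂ (A.br₀ x₁ x₂ x₃) x₄ x₅ + F₂ x₃ (A.br₀ x₁ x₂ x₄) x₅ + F₂ x₃ x₄ (A.br₀ x₁ x₂ x₅)]
    [B.br₁ (B.one (F₀ x₁)) (B.one (F₀ x₂)) (F₂ x₃ x₄ x₅),
     F₂ x₁ x₂ (A.br₀ x₃ x₄ x₅),
     F₁ (A.Jac x₁ x₂ x₃ x₄ x₅)]

/-- A 2-homomorphism of Lie triple 2-systems. -/
@[ext] structure TwoHom {A B : LT2.{w, u} k} (F G : Hom A B) where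
  θ : A.Ob →ₗ[k] B.Mor
  s_θ : ∀ x, B.s (θ x) = F.F₀ x
  t_θ : ∀ x, B.t (θ x) = G.F₀ x
  nat : ∀ f, B.Commutes [F.F₁ f, θ (A.t f)] [θ (A.s f), G.F₁ f]
  coh : ∀ x y z, B.Commutes
    [F.F₂ x y z, θ (A.br₀ x y z)] [B.br₁ (θ x) (θ y) (θ z), G.F₂ x y z]

theorem Hom.ext_data {A B : LT2.{w, u} k} {F G : Hom A B} (h : F.toHomData = G.toHomData) :
    F = G := by
  cases F; cases G; cases h; rfl

section Lemmas

variable {A B : LT2.{w, u} k}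

theorem Hom.nat_eq (F : Hom A B) (f g h) : F.F₁ (A.br₁ f g h) =
    B.br₁ (F.F₁ f) (F.F₁ g) (F.F₁ h) + F.F₂ (A.t f) (A.t g) (A.t h)
      - F.F₂ (A.s f) (A.s g) (A.s h)
      + B.one (F.F₀ (A.br₀ (A.s f) (A.s g) (A.s h)))
      - B.one (B.br₀ (F.F₀ (A.t f)) (F.F₀ (A.t g)) (F.F₀ (A.t h))) := by
  have h := ((B.commutes₂₂ _ _ _ _).1 (F.F₂_nat f g h)).2.2
  simp only [B.t_br, F.t_F₁, F.t_F₂] at h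
  linear_combination (norm := abel) -h

theorem TwoHom.nat_eq {F G : Hom A B} (σ : TwoHom F G) (f) : G.F₁ f =
    F.F₁ f + σ.θ (A.t f) - σ.θ (A.s f) + B.one (G.F₀ (A.s f)) - B.one (F.F₀ (A.t f)) := by
  have h := ((B.commutes₂₂ _ _ _ _).1 (σ.nat f)).2.2
  simp only [F.t_F₁, σ.t_θ] at h
  linear_combination (norm := abel) -h

end Lemmas

/-- The identity homomorphism. -/
def Hom.id (A : LT2.{w, u} k) : Hom A A where
  F₀ := LinearMap.id
  F₁ := LinearMap.id
  F₂ := trilin (fun x y z => A.one (A.br₀ x y z)) (by simp) (by simp) (by simp) (by simp)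
    (by simp) (by simp)
  s_F₁ _ := rfl
  t_F₁ _ := rfl
  F₁_one _ := rfl
  F₁_comp f g h := by
    rw [A.commutes₂₁, A.cmp_eq]
    exact ⟨h, rfl⟩
  s_F₂ _ _ _ := A.s_one _
  t_F₂ _ _ _ := A.t_one _
  F₂_nat f g h := by
    rw [A.commutes₂₂]
    simp [A.s_br, A.t_br, A.s_one, A.t_one]
  alt x y := by simp [A.br₀_alt]
  cyc x y z := by
    have h := congrArg A.one (A.br₀_cyc x y z)
    simp only [map_add, map_zero] at h
    simp only [trilin_apply]
    linear_combination (norm := abel) h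
  coh x₁ x₂ x₃ x₄ x₅ := by
    rw [A.commutes₃₃]
    simp [A.s_one, A.t_one, A.s_Jac, A.t_Jac, A.br_one]

/-- The composite of `F` followed by `G`. -/
def Hom.comp {A B C : LT2.{w, u} k} (F : Hom A B) (G : Hom B C) : Hom A C where
  F₀ := G.F₀ ∘ₗ F.F₀
  F₁ := G.F₁ ∘ₗ F.F₁
  F₂ := trilin (fun x y z => C.cmp (G.F₂ (F.F₀ x) (F.F₀ y) (F.F₀ z)) (G.F₁ (F.F₂ x y z))
      (by rw [G.t_F₂, G.s_F₁, F.s_F₂]))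
    (by intros; simp [C.cmp_eq]; abel) (by intros; simp [C.cmp_eq, smul_sub])
    (by intros; simp [C.cmp_eq]; abel) (by intros; simp [C.cmp_eq, smul_sub])
    (by intros; simp [C.cmp_eq]; abel) (by intros; simp [C.cmp_eq, smul_sub])
  s_F₁ f := by simp [F.s_F₁, G.s_F₁]
  t_F₁ f := by simp [F.t_F₁, G.t_F₁]
  F₁_one x := by simp [F.F₁_one, G.F₁_one]
  F₁_comp f g h := by
    rw [C.commutes₂₁, A.cmp_eq]
    simp [F.s_F₁, G.s_F₁, F.t_F₁, G.t_F₁, F.F₁_one, G.F₁_one, h]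
  s_F₂ x y z := by simp [C.cmp_eq, G.s_F₂, G.t_F₂, G.s_F₁, F.s_F₂, C.s_one]
  t_F₂ x y z := by simp [C.cmp_eq, G.t_F₂, G.t_F₁, F.t_F₂, C.t_one]
  F₂_nat f g h := by
    rw [C.commutes₂₂]
    simp only [trilin_apply, C.cmp_eq, LinearMap.comp_apply, map_add, map_sub, C.s_br, C.t_br,
      G.s_F₂, G.t_F₂, F.s_F₂, F.t_F₂, G.s_F₁, G.t_F₁, F.s_F₁, F.t_F₁, C.s_one, C.t_one,
      F.nat_eq, G.nat_eq, G.F₁_one]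
    refine ⟨by abel, by abel, by abel⟩
  alt x y := by
    have h := F.alt x y
    simp [C.cmp_eq, F.alt, G.alt, G.t_F₂, B.br₀_alt]
  cyc x y z := by
    have h := congrArg (fun x => C.one (G.F₀ x)) (B.br₀_cyc (F.F₀ x) (F.F₀ y) (F.F₀ z))
    have h₁ := congrArg G.F₁ (F.cyc x y z)
    have h₂ := G.cyc (F.F₀ x) (F.F₀ y) (F.F₀ z)
    simp only [trilin_apply, C.cmp_eq, map_add, map_sub, map_neg, map_zero, G.t_F₂] at *
    linear_combination (norm := abel) h₁ + h₂ - h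
  coh x₁ x₂ x₃ x₄ x₅ := by
    have hF := congrArg G.F₁ ((B.commutes₃₃ _ _ _ _ _ _).1 (F.coh x₁ x₂ x₃ x₄ x₅)).2.2
    have hG := ((C.commutes₃₃ _ _ _ _ _ _).1
      (G.coh (F.F₀ x₁) (F.F₀ x₂) (F.F₀ x₃) (F.F₀ x₄) (F.F₀ x₅))).2.2
    rw [C.commutes₃₃]
    simp only [trilin_apply, C.cmp_eq, LinearMap.comp_apply, map_add, map_sub,
      LinearMap.add_apply, LinearMap.sub_apply, C.s_br, C.t_br, B.t_br, B.s_one,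
      B.t_one, G.s_F₂, G.t_F₂, F.s_F₂, F.t_F₂, G.s_F₁, G.t_F₁, F.s_F₁, C.s_one, C.t_one,
      G.nat_eq, G.F₁_one, A.s_Jac, B.t_Jac, C.t_Jac, C.br_one] at *
    refine ⟨⟨by abel, by abel⟩, ⟨by abel, by abel⟩, ?_⟩
    linear_combination (norm := abel) hF + hG

/-- The identity 2-homomorphism. -/
def TwoHom.id {A B : LT2.{w, u} k} (F : Hom A B) : TwoHom F F where
  θ := B.one ∘ₗ F.F₀
  s_θ _ := B.s_one _
  t_θ _ := B.t_one _
  nat f := by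
    rw [B.commutes₂₂]
    simp [F.s_F₁, F.t_F₁, B.s_one, B.t_one]
  coh x y z := by
    rw [B.commutes₂₂]
    simp [F.s_F₂, F.t_F₂, B.s_one, B.t_one, B.br_one]

/-- Vertical composition of 2-homomorphisms. -/
def TwoHom.vcomp {A B : LT2.{w, u} k} {F G H : Hom A B} (σ : TwoHom F G) (τ : TwoHom G H) :
    TwoHom F H where
  θ := {
    toFun := fun x => B.cmp (σ.θ x) (τ.θ x) (by rw [σ.t_θ, τ.s_θ])
    map_add' := by intros; simp [B.cmp_eq]; abel
    map_smul' := by intros; simp [B.cmp_eq, smul_sub] }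
  s_θ x := by simp [B.cmp_eq, σ.s_θ, σ.t_θ, τ.s_θ, B.s_one]
  t_θ x := by simp [B.cmp_eq, σ.t_θ, τ.t_θ, B.t_one]
  nat f := by
    rw [B.commutes₂₂]
    simp only [LinearMap.coe_mk, AddHom.coe_mk, B.cmp_eq, map_add, map_sub, σ.s_θ, σ.t_θ, τ.s_θ,
      τ.t_θ, B.s_one, B.t_one, F.t_F₁, σ.nat_eq, τ.nat_eq, F.s_F₁]
    refine ⟨by abel, by abel, by abel⟩
  coh x y z := by
    have h₁ := ((B.commutes₂₂ _ _ _ _).1 (σ.coh x y z)).2.2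
    have h₂ := ((B.commutes₂₂ _ _ _ _).1 (τ.coh x y z)).2.2
    have h₃ := ((B.commutes₂₁ _ _ _).1 (B.br_comp (σ.θ x) (τ.θ x) (σ.θ y) (τ.θ y) (σ.θ z) (τ.θ z)
      (by rw [σ.t_θ, τ.s_θ]) (by rw [σ.t_θ, τ.s_θ]) (by rw [σ.t_θ, τ.s_θ]))).2
    rw [B.commutes₂₂]
    simp only [LinearMap.coe_mk, AddHom.coe_mk]
    rw [← h₃]
    simp only [B.cmp_eq, map_add, map_sub, σ.s_θ, σ.t_θ, τ.s_θ, τ.t_θ, B.s_one, B.t_one, B.t_br,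
      F.t_F₂, G.t_F₂, H.s_F₂] at *
    refine ⟨by abel, by abel, ?_⟩
    linear_combination (norm := abel) h₁ + h₂

/-- Whiskering `F` followed by `σ`. -/
def TwoHom.whiskerLeft {A B C : LT2.{w, u} k} (F : Hom A B) {G H : Hom B C} (σ : TwoHom G H) :
    TwoHom (F.comp G) (F.comp H) where
  θ := σ.θ ∘ₗ F.F₀
  s_θ x := by simp [σ.s_θ, Hom.comp]
  t_θ x := by simp [σ.t_θ, Hom.comp]
  nat f := by
    have h := σ.nat (F.F₁ f)
    rwa [F.s_F₁, F.t_F₁] at h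
  coh x y z := by
    have h₁ := ((C.commutes₂₂ _ _ _ _).1 (σ.coh (F.F₀ x) (F.F₀ y) (F.F₀ z))).2.2
    have h₂ := σ.nat_eq (F.F₂ x y z)
    rw [C.commutes₂₂]
    simp only [Hom.comp, trilin_apply, LinearMap.comp_apply, C.cmp_eq, map_add, map_sub,
      C.t_br, C.s_one, C.t_one, σ.s_θ, σ.t_θ, G.t_F₂, H.s_F₂, H.t_F₂, G.t_F₁, H.s_F₁,
      F.s_F₂, F.t_F₂] at *
    refine ⟨by abel, by abel, ?_⟩
    linear_combination (norm := abel) h₁ - h₂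

/-- Whiskering `σ` followed by `H`. -/
def TwoHom.whiskerRight {A B C : LT2.{w, u} k} {F G : Hom A B} (σ : TwoHom F G) (H : Hom B C) :
    TwoHom (F.comp H) (G.comp H) where
  θ := H.F₁ ∘ₗ σ.θ
  s_θ x := by simp [σ.s_θ, Hom.comp, H.s_F₁]
  t_θ x := by simp [σ.t_θ, Hom.comp, H.t_F₁]
  nat f := by
    rw [C.commutes₂₂]
    simp only [Hom.comp, LinearMap.comp_apply, H.s_F₁, H.t_F₁, F.s_F₁, F.t_F₁, σ.s_θ, σ.t_θ,
      σ.nat_eq, map_add, map_sub, H.F₁_one, C.s_one]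
    refine ⟨trivial, by abel, by abel⟩
  coh x y z := by
    have h₁ := congrArg H.F₁ ((B.commutes₂₂ _ _ _ _).1 (σ.coh x y z)).2.2
    rw [C.commutes₂₂]
    simp only [Hom.comp, trilin_apply, LinearMap.comp_apply, C.cmp_eq, map_add, map_sub,
      C.t_br, C.s_one, C.t_one, σ.s_θ, σ.t_θ, H.s_F₂, H.t_F₂, H.s_F₁, H.t_F₁, H.nat_eq, H.F₁_one,
      F.t_F₂, G.s_F₂, B.t_br] at *
    refine ⟨by abel, by abel, ?_⟩
    linear_combination (norm := abel) h₁

instance (A B : LT2.{w, u} k) : Category (Hom A B) where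
  Hom := TwoHom
  id := TwoHom.id
  comp := TwoHom.vcomp
  id_comp σ := TwoHom.ext (by
    ext x; simp [TwoHom.vcomp, TwoHom.id, B.cmp_eq, B.t_one])
  comp_id σ := TwoHom.ext (by
    ext x; simp [TwoHom.vcomp, TwoHom.id, B.cmp_eq, σ.t_θ])
  assoc σ τ υ := TwoHom.ext (by
    ext x; simp [TwoHom.vcomp, B.cmp_eq, σ.t_θ, τ.t_θ, B.t_one]; abel)

theorem Hom.comp_F₂ {A B C : LT2.{w, u} k} (F : Hom A B) (G : Hom B C) (x y z : A.Ob) :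
    (F.comp G).F₂ x y z = G.F₂ (F.F₀ x) (F.F₀ y) (F.F₀ z) + G.F₁ (F.F₂ x y z)
      - C.one (G.F₀ (B.br₀ (F.F₀ x) (F.F₀ y) (F.F₀ z))) := by
  rw [← G.t_F₂]
  exact C.cmp_eq _ _ _

theorem Hom.comp_F₀ {A B C : LT2.{w, u} k} (F : Hom A B) (G : Hom B C) (x : A.Ob) :
    (F.comp G).F₀ x = G.F₀ (F.F₀ x) := rfl

theorem Hom.comp_F₁ {A B C : LT2.{w, u} k} (F : Hom A B) (G : Hom B C) (f : A.Mor) :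
    (F.comp G).F₁ f = G.F₁ (F.F₁ f) := rfl

theorem Hom.id_F₂ (A : LT2.{w, u} k) (x y z : A.Ob) :
    (Hom.id A).F₂ x y z = A.one (A.br₀ x y z) := rfl

theorem Hom.ext_apply {A B : LT2.{w, u} k} {F G : Hom A B} (h₀ : F.F₀ = G.F₀) (h₁ : F.F₁ = G.F₁)
    (h₂ : ∀ x y z, F.F₂ x y z = G.F₂ x y z) : F = G :=
  Hom.ext_data (HomData.ext h₀ h₁ (by ext x y z; exact h₂ x y z))

theorem Hom.id_comp {A B : LT2.{w, u} k} (F : Hom A B) : (Hom.id A).comp F = F :=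
  Hom.ext_apply rfl rfl fun x y z => by
    rw [Hom.comp_F₂, Hom.id_F₂, F.F₁_one]
    exact add_sub_cancel_right _ _

theorem Hom.comp_id {A B : LT2.{w, u} k} (F : Hom A B) : F.comp (Hom.id B) = F :=
  Hom.ext_apply rfl rfl fun x y z => by
    rw [Hom.comp_F₂, Hom.id_F₂]
    exact add_sub_cancel_left _ _

theorem Hom.assoc {A B C D : LT2.{w, u} k} (F : Hom A B) (G : Hom B C) (H : Hom C D) :
    (F.comp G).comp H = F.comp (G.comp H) :=
  Hom.ext_apply (LinearMap.ext fun x => by simp only [Hom.comp_F₀])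
    (LinearMap.ext fun x => by simp only [Hom.comp_F₁]) fun x y z => by
    simp only [Hom.comp_F₂, Hom.comp_F₀, Hom.comp_F₁, map_add, map_sub, H.F₁_one]
    abel

theorem twoHom_ext {A B : LT2.{w, u} k} {F G : Hom A B} {σ τ : F ⟶ G}
    (h : ∀ x, TwoHom.θ σ x = TwoHom.θ τ x) : σ = τ :=
  TwoHom.ext (LinearMap.ext h)

theorem comp_θ {A B : LT2.{w, u} k} {F G H : Hom A B} (σ : F ⟶ G) (τ : G ⟶ H) (x : A.Ob) :
    TwoHom.θ (σ ≫ τ) x = TwoHom.θ σ x + TwoHom.θ τ x - B.one (G.F₀ x) := by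
  have h : TwoHom.θ (σ ≫ τ) x = TwoHom.θ σ x + TwoHom.θ τ x - B.one (B.t (TwoHom.θ σ x)) :=
    B.cmp_eq _ _ _
  rw [h, TwoHom.t_θ]

/-- The identity 2-homomorphism between equal homomorphisms. -/
def oneIso {A B : LT2.{w, u} k} {F G : Hom A B} (h : F = G) : F ≅ G where
  hom := { TwoHom.id F with
    t_θ := by subst h; exact (TwoHom.id F).t_θ
    nat := by subst h; exact (TwoHom.id F).nat
    coh := by subst h; exact (TwoHom.id F).coh }
  inv := { TwoHom.id G with
    t_θ := by subst h; exact (TwoHom.id F).t_θ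
    nat := by subst h; exact (TwoHom.id F).nat
    coh := by subst h; exact (TwoHom.id F).coh }
  hom_inv_id := by subst h; exact Category.id_comp (𝟙 F)
  inv_hom_id := by subst h; exact Category.id_comp (𝟙 F)

theorem oneIso_eq {A B : LT2.{w, u} k} {F G : Hom A B} (h : F = G) : oneIso h = eqToIso h := by
  subst h; rfl

theorem oneIso_hom_θ {A B : LT2.{w, u} k} {F G : Hom A B} (h : F = G) (x : A.Ob) :
    TwoHom.θ (oneIso h).hom x = B.one (F.F₀ x) := rfl

theorem oneIso_inv_θ {A B : LT2.{w, u} k} {F G : Hom A B} (h : F = G) (x : A.Ob) :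
    TwoHom.θ (oneIso h).inv x = B.one (G.F₀ x) := rfl

theorem whiskerLeft_θ {A B C : LT2.{w, u} k} (F : Hom A B) {G H : Hom B C} (σ : TwoHom G H)
    (x : A.Ob) : (TwoHom.whiskerLeft F σ).θ x = σ.θ (F.F₀ x) := rfl

theorem whiskerRight_θ {A B C : LT2.{w, u} k} {F G : Hom A B} (σ : TwoHom F G) (H : Hom B C)
    (x : A.Ob) : (TwoHom.whiskerRight σ H).θ x = H.F₁ (σ.θ x) := rfl

theorem id_θ {A B : LT2.{w, u} k} (F : Hom A B) (x : A.Ob) :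
    TwoHom.θ (𝟙 F) x = B.one (F.F₀ x) := rfl

/-- The 2-category of Lie triple 2-systems. -/
instance : Bicategory (LT2.{w, u} k) where
  Hom := Hom
  id := Hom.id
  comp := Hom.comp
  homCategory := inferInstance
  whiskerLeft F _ _ σ := TwoHom.whiskerLeft F σ
  whiskerRight σ H := TwoHom.whiskerRight σ H
  associator F G H := oneIso (Hom.assoc F G H)
  leftUnitor F := oneIso (Hom.id_comp F)
  rightUnitor F := oneIso (Hom.comp_id F)
  whiskerLeft_id _ _ := twoHom_ext fun _ => rfl
  whiskerLeft_comp _ _ _ _ _ _ := twoHom_ext fun _ => rfl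
  id_whiskerLeft σ := twoHom_ext fun x => by
    rw [comp_θ, comp_θ, oneIso_hom_θ, oneIso_inv_θ, whiskerLeft_θ]
    simp [Hom.comp, Hom.id]
  comp_whiskerLeft _ _ _ _ σ := twoHom_ext fun x => by
    rw [comp_θ, comp_θ, oneIso_hom_θ, oneIso_inv_θ, whiskerLeft_θ]
    simp [Hom.comp]; rfl
  id_whiskerRight F G := twoHom_ext fun x => by
    rw [whiskerRight_θ, id_θ, id_θ, G.F₁_one]; rfl
  comp_whiskerRight σ τ H := twoHom_ext fun x => by
    rw [whiskerRight_θ, comp_θ, comp_θ, map_sub, map_add, H.F₁_one]; rfl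
  whiskerRight_id σ := twoHom_ext fun x => by
    rw [comp_θ, comp_θ, oneIso_hom_θ, oneIso_inv_θ, whiskerRight_θ]
    simp [Hom.comp, Hom.id]
  whiskerRight_comp _ _ _ := twoHom_ext fun x => by
    rw [comp_θ, comp_θ, oneIso_hom_θ, oneIso_inv_θ, whiskerRight_θ]
    simp [Hom.comp]; rfl
  whisker_assoc _ _ _ _ _ := twoHom_ext fun x => by
    rw [comp_θ, comp_θ, oneIso_hom_θ, oneIso_inv_θ, whiskerRight_θ]
    simp [Hom.comp, whiskerLeft_θ]; rfl
  whisker_exchange {A B C F G H K} σ τ := twoHom_ext fun x => by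
    rw [comp_θ, comp_θ, whiskerRight_θ, whiskerRight_θ, whiskerLeft_θ, whiskerLeft_θ,
      TwoHom.nat_eq τ, TwoHom.t_θ, TwoHom.s_θ]
    simp only [Hom.comp, LinearMap.comp_apply]
    abel
  pentagon {A B C D E} F G H K := twoHom_ext fun x => by
    rw [comp_θ, comp_θ, comp_θ, whiskerRight_θ, whiskerLeft_θ]
    have h : ∀ y, K.F₁ (D.one y) + (E.one (K.F₀ y) + E.one (K.F₀ y) - E.one (K.F₀ y))
        - E.one (K.F₀ y) = E.one (K.F₀ y) + E.one (K.F₀ y) - E.one (K.F₀ y) := fun y => by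
      rw [K.F₁_one]; abel
    exact h (H.F₀ (G.F₀ (F.F₀ x)))
  triangle {A B C} F G := twoHom_ext fun x => by
    rw [comp_θ, whiskerRight_θ, whiskerLeft_θ]
    have h : ∀ y, C.one (G.F₀ y) + C.one (G.F₀ y) - C.one (G.F₀ y) = G.F₁ (B.one y) :=
      fun y => by rw [G.F₁_one]; abel
    exact h (F.F₀ x)

instance : Bicategory.Strict (LT2.{w, u} k) where
  id_comp := Hom.id_comp
  comp_id := Hom.comp_id
  assoc := Hom.assoc
  leftUnitor_eqToIso _ := oneIso_eq _
  rightUnitor_eqToIso _ := oneIso_eq _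
  associator_eqToIso _ _ _ := oneIso_eq _

end LT2

/-! ### The explicit 2-functors -/

section Explicit

variable {k : Type w} [Field k]

/-- The Lie triple 2-system assigned to a 2-term homotopy Lie triple system (its data). -/
abbrev TObj (X : HLTSData.{w, u} k) : LT2Data.{w, u} k where
  Ob := X.X₀
  Mor := X.X₀ × X.X₁
  s := LinearMap.fst k X.X₀ X.X₁
  t := LinearMap.fst k X.X₀ X.X₁ + X.d ∘ₗ LinearMap.snd k X.X₀ X.X₁
  one := LinearMap.inl k X.X₀ X.X₁
  comp := {
    toFun := fun p => (p.1.1.1, p.1.1.2 + p.1.2.2)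
    map_add' := fun p q => by ext <;> simp; abel
    map_smul' := fun c p => by ext <;> simp }
  s_one _ := rfl
  t_one x := by simp
  s_comp _ _ _ := rfl
  t_comp f g h := by
    have h' : f.1 + X.d f.2 = g.1 := h
    simp [← h', add_assoc]
  one_comp f := by ext <;> simp
  comp_one f := by ext <;> simp
  assoc f g h _ _ := by ext <;> simp [add_assoc]
  br₀ := X.br
  br₁ := trilin (fun P Q R => (X.br P.1 Q.1 R.1,
      X.brR P.1 Q.1 R.2 + X.brM P.1 Q.2 R.1 + X.brL P.2 Q.1 R.1
        + X.brM (X.d P.2) Q.2 R.1 + X.brR (X.d P.2) Q.1 R.2 + X.brR P.1 (X.d Q.2) R.2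
        + X.brR (X.d P.2) (X.d Q.2) R.2))
    (by intros; ext <;> simp; abel) (by intros; ext <;> simp)
    (by intros; ext <;> simp; abel) (by intros; ext <;> simp)
    (by intros; ext <;> simp; abel) (by intros; ext <;> simp)
  Jac := pentalin (fun x₁ x₂ x₃ x₄ x₅ => (X.br x₁ x₂ (X.br x₃ x₄ x₅), X.J x₁ x₂ x₃ x₄ x₅))
    (by intros; ext <;> simp) (by intros; ext <;> simp) (by intros; ext <;> simp)
    (by intros; ext <;> simp) (by intros; ext <;> simp) (by intros; ext <;> simp)
    (by intros; ext <;> simp) (by intros; ext <;> simp) (by intros; ext <;> simp)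
    (by intros; ext <;> simp)

/-- `(x, y, z) ↦ ([φ₀ x, φ₀ y, φ₀ z], φ₂ (x, y, z))`. -/
def TMapF₂ {X Y : HLTSData.{w, u} k} (φ : HLTS.HomData X Y) :
    X.X₀ →ₗ[k] X.X₀ →ₗ[k] X.X₀ →ₗ[k] (Y.X₀ × Y.X₁) :=
  trilin (fun x y z => (Y.br (φ.φ₀ x) (φ.φ₀ y) (φ.φ₀ z), φ.φ₂ x y z))
    (by intros; ext <;> simp) (by intros; ext <;> simp) (by intros; ext <;> simp)
    (by intros; ext <;> simp) (by intros; ext <;> simp) (by intros; ext <;> simp)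

/-- The homomorphism of Lie triple 2-systems assigned to a homomorphism of 2-term homotopy Lie
triple systems (its data). -/
def TMap {X Y : HLTSData.{w, u} k} (φ : HLTS.HomData X Y) : LT2.HomData (TObj X) (TObj Y) where
  F₀ := φ.φ₀
  F₁ := LinearMap.prodMap φ.φ₀ φ.φ₁
  F₂ := TMapF₂ φ

/-- The natural transformation assigned to a 2-homomorphism of 2-term homotopy Lie triple
systems, `x ↦ (φ₀ x, τ x)`. -/
def TMap₂ {X Y : HLTS.{w, u} k} {φ ψ : HLTS.Hom X Y} (σ : HLTS.TwoHom φ ψ) :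
    (TObj X.toHLTSData).Ob →ₗ[k] (TObj Y.toHLTSData).Mor :=
  LinearMap.prod φ.φ₀ σ.τ

/-- The arrow part `f - 1_{s f}` of a morphism of a 2-vector space. -/
def TwoVect.arrow (V : TwoVect.{w, u} k) : V.Mor →ₗ[k] LinearMap.ker V.s :=
  LinearMap.codRestrict (LinearMap.ker V.s) (LinearMap.id - V.one ∘ₗ V.s)
    (fun f => by simp [V.s_one])

/-- The 2-term homotopy Lie triple system assigned to a Lie triple 2-system (its data). -/
abbrev SObj (L : LT2.{w, u} k) : HLTSData.{w, u} k where
  X₀ := L.Ob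
  X₁ := LinearMap.ker L.s
  d := L.t ∘ₗ (LinearMap.ker L.s).subtype
  br := L.br₀
  brL := trilin (fun f x y => ⟨L.br₁ f (L.one x) (L.one y), by simp [L.s_br]⟩)
    (by intros; ext; simp) (by intros; ext; simp) (by intros; ext; simp)
    (by intros; ext; simp) (by intros; ext; simp) (by intros; ext; simp)
  brM := trilin (fun x f y => ⟨L.br₁ (L.one x) f (L.one y), by simp [L.s_br]⟩)
    (by intros; ext; simp) (by intros; ext; simp) (by intros; ext; simp)
    (by intros; ext; simp) (by intros; ext; simp) (by intros; ext; simp)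
  brR := trilin (fun x y f => ⟨L.br₁ (L.one x) (L.one y) f, by simp [L.s_br]⟩)
    (by intros; ext; simp) (by intros; ext; simp) (by intros; ext; simp)
    (by intros; ext; simp) (by intros; ext; simp) (by intros; ext; simp)
  J := pentalin (fun x₁ x₂ x₃ x₄ x₅ => L.arrow (L.Jac x₁ x₂ x₃ x₄ x₅))
    (by simp) (by simp) (by simp) (by simp) (by simp) (by simp) (by simp) (by simp) (by simp)
    (by simp)

/-- `(x, y, z) ↦ F₂ (x, y, z) - 1_{s (F₂ (x, y, z))}`. -/
def SMapφ₂ {L M : LT2Data.{w, u} k} (F : LT2.HomData L M) :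
    L.Ob →ₗ[k] L.Ob →ₗ[k] L.Ob →ₗ[k] LinearMap.ker M.s :=
  trilin (fun x y z => M.arrow (F.F₂ x y z))
    (by simp) (by simp) (by simp) (by simp) (by simp) (by simp)

/-- The homomorphism of 2-term homotopy Lie triple systems assigned to a homomorphism of Lie
triple 2-systems (its data). -/
def SMap {L M : LT2.{w, u} k} (F : LT2.Hom L M) : HLTS.HomData (SObj L) (SObj M) where
  φ₀ := F.F₀
  φ₁ := LinearMap.restrict F.F₁ (p := LinearMap.ker L.s) (q := LinearMap.ker M.s)
    (fun f hf => by
      rw [LinearMap.mem_ker] at hf ⊢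
      rw [F.s_F₁, hf, map_zero])
  φ₂ := SMapφ₂ F.toHomData

/-- The chain homotopy assigned to a 2-homomorphism of Lie triple 2-systems,
`x ↦ θ x - 1_{s (θ x)}`. -/
def SMap₂ {L M : LT2.{w, u} k} {F G : LT2.Hom L M} (σ : LT2.TwoHom F G) :
    (SObj L).X₀ →ₗ[k] (SObj M).X₁ :=
  M.arrow ∘ₗ σ.θ

/-- The strict 2-functor `T` is given by the formulas above. (The second and third condition are
heterogeneous equalities only because source and target of `T.map φ` are described by an equality
of objects, the first condition.) -/
structure IsExplicitT (T : StrictPseudofunctor (HLTS.{w, u} k) (LT2.{w, u} k)) : Prop where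
  obj : ∀ X, (T.obj X).toLT2Data = TObj X.toHLTSData
  map : ∀ {X Y : HLTS.{w, u} k} (φ : X ⟶ Y),
    HEq (LT2.Hom.toHomData (T.map φ)) (TMap (HLTS.Hom.toHomData φ))
  map₂ : ∀ {X Y : HLTS.{w, u} k} {φ ψ : X ⟶ Y} (σ : φ ⟶ ψ),
    HEq (LT2.TwoHom.θ (T.map₂ σ)) (TMap₂ σ)

/-- The strict 2-functor `S` is given by the formulas above. -/
structure IsExplicitS (S : StrictPseudofunctor (LT2.{w, u} k) (HLTS.{w, u} k)) : Prop where
  obj : ∀ L, (S.obj L).toHLTSData = SObj L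
  map : ∀ {L M : LT2.{w, u} k} (F : L ⟶ M),
    HEq (HLTS.Hom.toHomData (S.map F)) (SMap F)
  map₂ : ∀ {L M : LT2.{w, u} k} {F G : L ⟶ M} (σ : F ⟶ G),
    HEq (HLTS.TwoHom.τ (S.map₂ σ)) (SMap₂ σ)

end Explicit

/-! ### 2-equivalence -/

/-- A 2-natural isomorphism between strict 2-functors: a strictly natural family of (strictly)
invertible 1-morphisms, natural with respect to 2-morphisms as well. -/
structure TwoNatIso {B C : Type*} [Bicategory B] [Bicategory C] (F G : StrictPseudofunctor B C) where
  app : ∀ a, F.obj a ⟶ G.obj a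
  inv : ∀ a, G.obj a ⟶ F.obj a
  app_inv : ∀ a, app a ≫ inv a = 𝟙 (F.obj a)
  inv_app : ∀ a, inv a ≫ app a = 𝟙 (G.obj a)
  naturality : ∀ {a b : B} (f : a ⟶ b), F.map f ≫ app b = app a ≫ G.map f
  naturality₂ : ∀ {a b : B} {f g : a ⟶ b} (η : f ⟶ g),
    F.map₂ η ▷ app b ≫ eqToHom (naturality g) = eqToHom (naturality f) ≫ app a ◁ G.map₂ η

/-- `T` and `S` are mutually quasi-inverse 2-equivalences: both composites are 2-naturally
isomorphic to the identity. -/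
def AreTwoEquivalences {B C : Type*} [Bicategory B] [Bicategory C] (T : StrictPseudofunctor B C)
    (S : StrictPseudofunctor C B) : Prop :=
  Nonempty (TwoNatIso (S.comp T) (StrictPseudofunctor.id C)) ∧
    Nonempty (TwoNatIso (T.comp S) (StrictPseudofunctor.id B))

end LieTriple

/-!
A morphism `f` of a 2-vector space is determined by its source and its arrow part `f - 1_{s f}`,
which lies in `ker s`. Composition adds arrow parts, so two paths have equal composites exactly when
they are paths, start at the same object and have the same sum of arrow parts. Under the resulting
isomorphism `L₁ ≅ L₀ ⊕ ker s`, the coherence axioms of Lie triple 2-systems turn into the axioms of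
2-term homotopy Lie triple systems. The mixed terms in the bracket of morphisms arise by moving
along one argument at a time: `f` is `f` followed by an identity and also an identity followed by
`f`, and the bracket is functorial. Skew-symmetry of a bracket on `T₀` or `T₋₁` gives
`{x, x, y} = 0` because `2` is invertible. Both round trips give back the original system up to an
isomorphism that preserves all the structure on the nose.
-/

namespace LieTriple

variable {k : Type w} [Field k]

namespace TwoVect

variable (V : TwoVect.{w, u} k)

theorem coe_arrow (f : V.Mor) : (V.arrow f : V.Mor) = f - V.one (V.s f) := rfl

theorem arrow_one (x : V.Ob) : V.arrow (V.one x) = 0 :=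
  Subtype.ext (by rw [coe_arrow, V.s_one, sub_self, ZeroMemClass.coe_zero])

theorem arrow_coe (h : LinearMap.ker V.s) : V.arrow h = h :=
  Subtype.ext (by rw [coe_arrow, LinearMap.map_coe_ker, map_zero, sub_zero])

theorem t_eq_s_add_t_arrow (f : V.Mor) : V.t f = V.s f + V.t (V.arrow f) := by
  rw [coe_arrow, map_sub, V.t_one, add_sub_cancel]

/-- A morphism of a 2-vector space amounts to its source together with its arrow part. -/
def morEquiv : V.Mor ≃ₗ[k] V.Ob × LinearMap.ker V.s where
  toLinearMap := V.s.prod V.arrow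
  invFun P := V.one P.1 + P.2
  left_inv f := add_sub_cancel (V.one (V.s f)) f
  right_inv P := by
    ext1
    · simp [V.s_one]
    · simp [V.arrow_one, V.arrow_coe]

theorem mor_ext {f g : V.Mor} (hs : V.s f = V.s g) (ha : V.arrow f = V.arrow g) : f = g :=
  V.morEquiv.injective (Prod.ext hs ha)

theorem arrow_cmp (f g : V.Mor) (h : V.t f = V.s g) :
    V.arrow (V.cmp f g h) = V.arrow f + V.arrow g := by
  rw [cmp_eq, map_sub, map_add, arrow_one, sub_zero]

/-- Consecutive morphisms of the list are composable. -/
abbrev IsPath (p : List V.Mor) : Prop := p.IsChain fun f g => V.t f = V.s g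

theorem isComposite_cons_iff (f : V.Mor) (p : List V.Mor) (m : V.Mor) :
    V.IsComposite (f :: p) m ↔
      V.IsPath (f :: p) ∧ V.s f = V.s m ∧ ((f :: p).map V.arrow).sum = V.arrow m := by
  induction p generalizing f m with
  | nil =>
    simp only [IsComposite, IsPath, List.isChain_singleton, List.map_cons, List.map_nil,
      List.sum_cons, List.sum_nil, add_zero, true_and]
    exact ⟨fun h => h ▸ ⟨rfl, rfl⟩, fun h => V.mor_ext h.1 h.2⟩
  | cons g q ih =>
    rw [IsComposite, IsPath, List.isChain_cons_cons, List.map_cons, List.sum_cons]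
    constructor
    · rintro ⟨n, hn, hfn, rfl⟩
      obtain ⟨hpath, hs, hsum⟩ := (ih g n).1 hn
      exact ⟨⟨hfn.trans hs.symm, hpath⟩, (V.s_comp f n hfn).symm, by rw [hsum, arrow_cmp]⟩
    · rintro ⟨⟨hfg, hpath⟩, hs, hsum⟩
      obtain ⟨n, hn⟩ := V.morEquiv.surjective (V.s g, ((g :: q).map V.arrow).sum)
      obtain ⟨hns, hna⟩ := Prod.ext_iff.1 hn
      have hfn : V.t f = V.s n := hfg.trans hns.symm
      exact ⟨n, (ih g n).2 ⟨hpath, hns.symm, hna.symm⟩, hfn,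
        V.mor_ext ((V.s_comp f n hfn).trans hs) (by rw [arrow_cmp, ← hsum]; exact congrArg _ hna)⟩

theorem commutes_iff_sum_arrow_eq (f g : V.Mor) (p q : List V.Mor) :
    V.Commutes (f :: p) (g :: q) ↔ V.IsPath (f :: p) ∧ V.IsPath (g :: q) ∧ V.s f = V.s g ∧
      ((f :: p).map V.arrow).sum = ((g :: q).map V.arrow).sum := by
  simp only [Commutes, isComposite_cons_iff]
  constructor
  · rintro ⟨m, ⟨hf, hfs, hfa⟩, hg, hgs, hga⟩
    exact ⟨hf, hg, hfs.trans hgs.symm, hfa.trans hga.symm⟩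
  · rintro ⟨hf, hg, hs, ha⟩
    obtain ⟨m, hm⟩ := V.morEquiv.surjective (V.s f, ((f :: p).map V.arrow).sum)
    obtain ⟨hms, hma⟩ := Prod.ext_iff.1 hm
    exact ⟨m, ⟨hf, hms.symm, hma.symm⟩, hg, hs.symm.trans hms.symm, ha.symm.trans hma.symm⟩

variable {V} in
theorem commutes_of_cmp_eq {f g m : V.Mor} (h : V.t f = V.s g) (hm : V.cmp f g h = m) :
    V.Commutes [f, g] [m] :=
  ⟨m, ⟨g, rfl, h, hm⟩, rfl⟩

end TwoVect

/-- The arrow part of the bracket of the morphisms `P`, `Q`, `R` of `TObj X`, where `(x, f)` stands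
for the morphism from `x` to `x + d f`. -/
def HLTSData.arrowBr (X : HLTSData.{w, u} k) (P Q R : X.X₀ × X.X₁) : X.X₁ :=
  X.brR P.1 Q.1 R.2 + X.brM P.1 Q.2 R.1 + X.brL P.2 Q.1 R.1
    + X.brM (X.d P.2) Q.2 R.1 + X.brR (X.d P.2) Q.1 R.2 + X.brR P.1 (X.d Q.2) R.2
    + X.brR (X.d P.2) (X.d Q.2) R.2

-- Composing one argument at a time: move along `P`, then along `Q`, then along `R`.
theorem HLTSData.arrowBr_eq (X : HLTSData.{w, u} k) (P Q R : X.X₀ × X.X₁) :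
    X.arrowBr P Q R = X.brL P.2 Q.1 R.1 + X.brM (P.1 + X.d P.2) Q.2 R.1
      + X.brR (P.1 + X.d P.2) (Q.1 + X.d Q.2) R.2 := by
  simp only [arrowBr, map_add, LinearMap.add_apply]
  abel

theorem eq_zero_of_eq_neg {R M : Type*} [DivisionRing R] [AddCommGroup M] [Module R M]
    (h2 : (2 : R) ≠ 0) {a : M} (h : a = -a) : a = 0 :=
  (smul_eq_zero.1 ((two_smul R a).trans (eq_neg_iff_add_eq_zero.1 h))).resolve_left h2

namespace HLTS

section

variable (X : HLTS.{w, u} k)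

theorem J_skew (x₁ x₂ x y z) : X.J x₁ x₂ x y z = -X.J x₁ x₂ y x z := by
  have h := X.J_alt x₁ x₂ (x + y) z
  simp only [map_add, LinearMap.add_apply, X.J_alt, zero_add, add_zero] at h
  exact eq_neg_of_add_eq_zero_right h

theorem J_d₄ (x₁ x₂ x₃ f x₅) : X.J x₁ x₂ x₃ (X.d f) x₅ =
    -X.brR x₁ x₂ (X.brM x₃ f x₅) + X.brM x₃ (X.brR x₁ x₂ f) x₅ + X.brM (X.br x₁ x₂ x₃) f x₅
      + X.brM x₃ f (X.br x₁ x₂ x₅) := by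
  rw [X.J_skew, X.J_d₃]
  simp only [X.brM_skew x₃, X.brM_skew (X.br x₁ x₂ x₃), map_neg]
  abel

theorem br_add_d_arrowBr (P Q R : X.X₀ × X.X₁) :
    X.br P.1 Q.1 R.1 + X.d (X.arrowBr P Q R) =
      X.br (P.1 + X.d P.2) (Q.1 + X.d Q.2) (R.1 + X.d R.2) := by
  simp only [X.arrowBr_eq, map_add, LinearMap.add_apply, X.d_brR, X.d_brM, X.d_brL]
  abel

theorem arrowBr_add (x y z : X.X₀) (f f' g g' h h' : X.X₁) :
    X.arrowBr (x, f + f') (y, g + g') (z, h + h') = X.arrowBr (x, f) (y, g) (z, h)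
      + X.arrowBr (x + X.d f, f') (y + X.d g, g') (z + X.d h, h') := by
  simp only [X.arrowBr_eq, map_add, LinearMap.add_apply, X.brM_d, X.brM_dR, X.brR_d]
  abel

theorem arrowBr_cyc (P Q R : X.X₀ × X.X₁) :
    X.arrowBr P Q R + X.arrowBr Q R P + X.arrowBr R P Q = 0 := by
  simp only [HLTSData.arrowBr, X.brM_d, X.brR_d]
  linear_combination (norm := (simp only [X.brM_d, X.brR_d]; abel))
    X.brR_cyc P.1 Q.1 R.2 + X.brR_cyc Q.1 R.1 P.2
    + X.brR_cyc R.1 P.1 Q.2 + X.brR_cyc P.1 (X.d Q.2) R.2 + X.brR_cyc Q.1 (X.d R.2) P.2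
    + X.brR_cyc R.1 (X.d P.2) Q.2 + X.brR_cyc (X.d P.2) (X.d Q.2) R.2

theorem arrowBr_skew (P Q R : X.X₀ × X.X₁) : X.arrowBr P Q R = -X.arrowBr Q P R := by
  have hM := X.brM_skew Q.1 P.2 R.1
  have hMd := X.brM_skew (X.d Q.2) P.2 R.1
  simp only [HLTSData.arrowBr, ← X.brM_d] at hMd ⊢
  linear_combination (norm := abel) X.brR_skew P.1 Q.1 R.2 + X.brM_skew P.1 Q.2 R.1 + hM + hMd
    + X.brR_skew (X.d P.2) Q.1 R.2 + X.brR_skew P.1 (X.d Q.2) R.2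
    + X.brR_skew (X.d P.2) (X.d Q.2) R.2

-- Moving from the sources to the targets one argument at a time, the difference of the two values
-- of `J` becomes a sum of five values of `J` at a boundary, which the axioms `J_dᵢ` compute.
theorem J_nat (x₁ x₂ x₃ x₄ x₅ : X.X₀) (f₁ f₂ f₃ f₄ f₅ : X.X₁) :
    X.arrowBr (x₁, f₁) (x₂, f₂) (X.br x₃ x₄ x₅, X.arrowBr (x₃, f₃) (x₄, f₄) (x₅, f₅))
      + X.J (x₁ + X.d f₁) (x₂ + X.d f₂) (x₃ + X.d f₃) (x₄ + X.d f₄) (x₅ + X.d f₅) =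
    X.J x₁ x₂ x₃ x₄ x₅
      + (X.arrowBr (X.br x₁ x₂ x₃, X.arrowBr (x₁, f₁) (x₂, f₂) (x₃, f₃)) (x₄, f₄) (x₅, f₅)
      + X.arrowBr (x₃, f₃) (X.br x₁ x₂ x₄, X.arrowBr (x₁, f₁) (x₂, f₂) (x₄, f₄)) (x₅, f₅)
      + X.arrowBr (x₃, f₃) (x₄, f₄) (X.br x₁ x₂ x₅, X.arrowBr (x₁, f₁) (x₂, f₂) (x₅, f₅))) := by
  have h₁ := X.J_d₁ f₁ x₂ x₃ x₄ x₅
  have h₂ := X.J_d₂ (x₁ + X.d f₁) f₂ x₃ x₄ x₅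
  have h₃ := X.J_d₃ (x₁ + X.d f₁) (x₂ + X.d f₂) f₃ x₄ x₅
  have h₄ := X.J_d₄ (x₁ + X.d f₁) (x₂ + X.d f₂) (x₃ + X.d f₃) f₄ x₅
  have h₅ := X.J_d₅ (x₁ + X.d f₁) (x₂ + X.d f₂) (x₃ + X.d f₃) (x₄ + X.d f₄) f₅
  simp only [X.arrowBr_eq, map_add, LinearMap.add_apply, X.d_brL, X.d_brM, X.d_brR,
    X.brM_d, ← X.brM_dR, X.brR_d] at h₁ h₂ h₃ h₄ h₅ ⊢
  linear_combination (norm := abel) h₁ + h₂ + h₃ + h₄ + h₅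

theorem arrowBr_self (h2 : (2 : k) ≠ 0) (P Q : X.X₀ × X.X₁) : X.arrowBr P P Q = 0 :=
  eq_zero_of_eq_neg h2 (X.arrowBr_skew P P Q)

end

theorem Hom.map_target {X Y : HLTS.{w, u} k} (φ : Hom X Y) (P : X.X₀ × X.X₁) :
    φ.φ₀ (P.1 + X.d P.2) = φ.φ₀ P.1 + Y.d (φ.φ₁ P.2) := by
  rw [map_add, φ.chain]

theorem Hom.br_add_d_φ₂ {X Y : HLTS.{w, u} k} (φ : Hom X Y) (x y z) :
    Y.br (φ.φ₀ x) (φ.φ₀ y) (φ.φ₀ z) + Y.d (φ.φ₂ x y z) = φ.φ₀ (X.br x y z) := by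
  rw [φ.d_φ₂, add_sub_cancel]

theorem Hom.arrowBr_nat {X Y : HLTS.{w, u} k} (φ : Hom X Y) (P Q R : X.X₀ × X.X₁) :
    Y.arrowBr (P.map φ.φ₀ φ.φ₁) (Q.map φ.φ₀ φ.φ₁) (R.map φ.φ₀ φ.φ₁)
        + φ.φ₂ (P.1 + X.d P.2) (Q.1 + X.d Q.2) (R.1 + X.d R.2) =
      φ.φ₂ P.1 Q.1 R.1 + φ.φ₁ (X.arrowBr P Q R) := by
  simp only [HLTSData.arrowBr, Prod.map_fst, Prod.map_snd, map_add, LinearMap.add_apply, φ.φ₂_L,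
    φ.φ₂_M, φ.φ₂_R, φ.chain, X.brM_d, ← X.brM_dR, X.brR_d, Y.brM_d, ← Y.brM_dR, Y.brR_d]
  abel

theorem TwoHom.φ₀_add_d_τ {X Y : HLTS.{w, u} k} {φ ψ : Hom X Y} (σ : TwoHom φ ψ) (x) :
    φ.φ₀ x + Y.d (σ.τ x) = ψ.φ₀ x := by
  rw [σ.d_τ, add_sub_cancel]

theorem TwoHom.arrowBr_nat {X Y : HLTS.{w, u} k} {φ ψ : Hom X Y} (σ : TwoHom φ ψ) (x y z) :
    φ.φ₂ x y z + σ.τ (X.br x y z) =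
      Y.arrowBr (φ.φ₀ x, σ.τ x) (φ.φ₀ y, σ.τ y) (φ.φ₀ z, σ.τ z) + ψ.φ₂ x y z := by
  rw [HLTSData.arrowBr, ← sub_eq_iff_eq_add, add_sub_right_comm, σ.coh]
  abel

end HLTS

/-- The morphisms with source `0` of the 2-vector space underlying `TObj X` are the elements of
degree `-1` of `X`. -/
def TObjKerEquiv (X : HLTSData.{w, u} k) : LinearMap.ker (TObj X).s ≃ₗ[k] X.X₁ where
  toLinearMap := LinearMap.snd k X.X₀ X.X₁ ∘ₗ (LinearMap.ker (TObj X).s).subtype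
  invFun f := ⟨(0, f), rfl⟩
  left_inv h := Subtype.ext (Prod.ext (LinearMap.mem_ker.1 h.2).symm rfl)
  right_inv _ := rfl

theorem TObjKerEquiv_arrow (X : HLTSData.{w, u} k) (P : X.X₀ × X.X₁) :
    TObjKerEquiv X ((TObj X).arrow P) = P.2 :=
  sub_zero P.2

theorem TObj_commutes_iff (X : HLTSData.{w, u} k) (P Q : X.X₀ × X.X₁) (p q : List (X.X₀ × X.X₁)) :
    (TObj X).Commutes (P :: p) (Q :: q) ↔ (TObj X).IsPath (P :: p) ∧ (TObj X).IsPath (Q :: q) ∧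
      P.1 = Q.1 ∧ ((P :: p).map Prod.snd).sum = ((Q :: q).map Prod.snd).sum := by
  have h : Prod.snd = fun R => TObjKerEquiv X ((TObj X).arrow R) :=
    funext fun R => (TObjKerEquiv_arrow X R).symm
  rw [TwoVect.commutes_iff_sum_arrow_eq, ← (TObjKerEquiv X).injective.eq_iff, map_list_sum,
    map_list_sum, List.map_map, List.map_map, h]
  rfl

theorem TObj_commutes_pair {X : HLTSData.{w, u} k} {P Q P' Q' : X.X₀ × X.X₁}
    (h : (TObj X).t P = Q.1) (h' : (TObj X).t P' = Q'.1) (hs : P.1 = P'.1)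
    (ha : P.2 + Q.2 = P'.2 + Q'.2) : (TObj X).Commutes [P, Q] [P', Q'] :=
  (TObj_commutes_iff X P P' [Q] [Q']).2
    ⟨List.isChain_pair.2 h, List.isChain_pair.2 h', hs, by simpa using ha⟩

namespace HLTS

section

variable (X : HLTS.{w, u} k)

theorem br_self (h2 : (2 : k) ≠ 0) (x y) : X.br x x y = 0 :=
  eq_zero_of_eq_neg h2 (X.br_skew x x y)

theorem TObj_t_br (P Q R) : (TObj X.toHLTSData).t ((TObj X.toHLTSData).br₁ P Q R) =
    X.br (P.1 + X.d P.2) (Q.1 + X.d Q.2) (R.1 + X.d R.2) :=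
  X.br_add_d_arrowBr P Q R

theorem TObj_br_comp (P P' Q Q' R R' : X.X₀ × X.X₁) (hP : P.1 + X.d P.2 = P'.1)
    (hQ : Q.1 + X.d Q.2 = Q'.1) (hR : R.1 + X.d R.2 = R'.1) :
    (TObj X.toHLTSData).Commutes
      [(TObj X.toHLTSData).br₁ P Q R, (TObj X.toHLTSData).br₁ P' Q' R']
      [(TObj X.toHLTSData).br₁ ((TObj X.toHLTSData).cmp P P' hP)
        ((TObj X.toHLTSData).cmp Q Q' hQ) ((TObj X.toHLTSData).cmp R R' hR)] := by
  have hcomp : (TObj X.toHLTSData).t ((TObj X.toHLTSData).br₁ P Q R) = X.br P'.1 Q'.1 R'.1 := by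
    rw [TObj_t_br, hP, hQ, hR]
  refine TwoVect.commutes_of_cmp_eq hcomp (Prod.ext rfl ?_)
  have h := X.arrowBr_add P.1 Q.1 R.1 P.2 P'.2 Q.2 Q'.2 R.2 R'.2
  rw [hP, hQ, hR] at h
  exact h.symm

theorem TObj_t_Jac (x₁ x₂ x₃ x₄ x₅) :
    (TObj X.toHLTSData).t ((TObj X.toHLTSData).Jac x₁ x₂ x₃ x₄ x₅) =
      X.br (X.br x₁ x₂ x₃) x₄ x₅ + X.br x₃ (X.br x₁ x₂ x₄) x₅ + X.br x₃ x₄ (X.br x₁ x₂ x₅) := by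
  change X.br x₁ x₂ (X.br x₃ x₄ x₅) + X.d (X.J x₁ x₂ x₃ x₄ x₅) = _
  rw [X.d_J]
  abel

theorem TObj_Jac_nat (P₁ P₂ P₃ P₄ P₅ : X.X₀ × X.X₁) :
    (TObj X.toHLTSData).Commutes
      [(TObj X.toHLTSData).br₁ P₁ P₂ ((TObj X.toHLTSData).br₁ P₃ P₄ P₅),
        (TObj X.toHLTSData).Jac ((TObj X.toHLTSData).t P₁) ((TObj X.toHLTSData).t P₂)
          ((TObj X.toHLTSData).t P₃) ((TObj X.toHLTSData).t P₄) ((TObj X.toHLTSData).t P₅)]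
      [(TObj X.toHLTSData).Jac ((TObj X.toHLTSData).s P₁) ((TObj X.toHLTSData).s P₂)
          ((TObj X.toHLTSData).s P₃) ((TObj X.toHLTSData).s P₄) ((TObj X.toHLTSData).s P₅),
        (TObj X.toHLTSData).br₁ ((TObj X.toHLTSData).br₁ P₁ P₂ P₃) P₄ P₅
          + (TObj X.toHLTSData).br₁ P₃ ((TObj X.toHLTSData).br₁ P₁ P₂ P₄) P₅
          + (TObj X.toHLTSData).br₁ P₃ P₄ ((TObj X.toHLTSData).br₁ P₁ P₂ P₅)] := by
  refine TObj_commutes_pair ?_ (X.TObj_t_Jac _ _ _ _ _) rfl (X.J_nat _ _ _ _ _ _ _ _ _ _)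
  rw [TObj_t_br]
  exact congrArg _ (X.br_add_d_arrowBr P₃ P₄ P₅)

theorem TObj_Jac_coh (x₁ x₂ x₃ x₄ x₅ x₆ x₇ : X.X₀) :
    let L := TObj X.toHLTSData
    L.Commutes
    [L.br₁ (L.one x₁) (L.one x₂) (L.Jac x₃ x₄ x₅ x₆ x₇),
     L.Jac x₁ x₂ (X.br x₃ x₄ x₅) x₆ x₇ + L.Jac x₁ x₂ x₅ (X.br x₃ x₄ x₆) x₇
      + L.Jac x₁ x₂ x₅ x₆ (X.br x₃ x₄ x₇),
     L.br₁ (L.one x₅) (L.one x₆) (L.Jac x₁ x₂ x₃ x₄ x₇)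
      + L.one (X.br (X.br x₁ x₂ (X.br x₃ x₄ x₅)) x₆ x₇ + X.br (X.br x₃ x₄ x₅) (X.br x₁ x₂ x₆) x₇
        + X.br (X.br x₃ x₄ x₅) x₆ (X.br x₁ x₂ x₇) + X.br (X.br x₁ x₂ x₅) (X.br x₃ x₄ x₆) x₇
        + X.br x₅ (X.br x₁ x₂ (X.br x₃ x₄ x₆)) x₇ + X.br x₅ (X.br x₃ x₄ x₆) (X.br x₁ x₂ x₇)
        + X.br (X.br x₁ x₂ x₅) x₆ (X.br x₃ x₄ x₇) + X.br x₅ (X.br x₁ x₂ x₆) (X.br x₃ x₄ x₇)),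
     L.br₁ (L.one x₅) (L.Jac x₁ x₂ x₃ x₄ x₆) (L.one x₇)
      + L.br₁ (L.Jac x₁ x₂ x₃ x₄ x₅) (L.one x₆) (L.one x₇)
      + L.one (X.br (X.br x₃ x₄ x₅) (X.br x₁ x₂ x₆) x₇ + X.br (X.br x₃ x₄ x₅) x₆ (X.br x₁ x₂ x₇)
        + X.br (X.br x₁ x₂ x₅) (X.br x₃ x₄ x₆) x₇ + X.br x₅ (X.br x₃ x₄ x₆) (X.br x₁ x₂ x₇)
        + X.br (X.br x₁ x₂ x₅) x₆ (X.br x₃ x₄ x₇) + X.br x₅ (X.br x₁ x₂ x₆) (X.br x₃ x₄ x₇)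
        + X.br x₅ x₆ (X.br (X.br x₁ x₂ x₃) x₄ x₇) + X.br x₅ x₆ (X.br x₃ (X.br x₁ x₂ x₄) x₇)
        + X.br x₅ x₆ (X.br x₃ x₄ (X.br x₁ x₂ x₇)))]
    [L.Jac x₁ x₂ x₃ x₄ (X.br x₅ x₆ x₇),
     L.br₁ (L.one x₃) (L.one x₄) (L.Jac x₁ x₂ x₅ x₆ x₇)
      + L.one (X.br (X.br x₁ x₂ x₃) x₄ (X.br x₅ x₆ x₇)
        + X.br x₃ (X.br x₁ x₂ x₄) (X.br x₅ x₆ x₇)),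
     L.Jac (X.br x₁ x₂ x₃) x₄ x₅ x₆ x₇ + L.Jac x₃ (X.br x₁ x₂ x₄) x₅ x₆ x₇
      + L.Jac x₃ x₄ (X.br x₁ x₂ x₅) x₆ x₇ + L.Jac x₃ x₄ x₅ (X.br x₁ x₂ x₆) x₇
      + L.Jac x₃ x₄ x₅ x₆ (X.br x₁ x₂ x₇)] := by
  have h := X.J_coh x₁ x₂ x₃ x₄ x₅ x₆ x₇
  rw [TObj_commutes_iff]
  simp only [List.isChain_cons_cons, List.isChain_singleton, and_true, List.map_cons,
    List.map_nil, List.sum_cons, List.sum_nil, map_add, trilin_apply, pentalin_apply,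
    LinearMap.inl_apply, LinearMap.fst_apply, LinearMap.snd_apply, LinearMap.comp_apply,
    LinearMap.add_apply, Prod.mk_add_mk, X.d_J, X.d_brR, map_zero, LinearMap.zero_apply, add_zero,
    zero_add, map_neg]
  refine ⟨⟨by abel, by abel, by abel⟩, ⟨by abel, by abel⟩, trivial, ?_⟩
  linear_combination (norm := abel) h

/-- The Lie triple 2-system assigned to a 2-term homotopy Lie triple system. -/
abbrev toLT2 (h2 : (2 : k) ≠ 0) : LT2.{w, u} k where
  toLT2Data := TObj X.toHLTSData
  s_br _ _ _ := rfl
  t_br := X.TObj_t_br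
  br_one x y z := Prod.ext rfl (by simp)
  br_comp := X.TObj_br_comp
  br₀_alt := X.br_self h2
  br₀_cyc := X.br_cyc
  br₁_alt P Q := Prod.ext (X.br_self h2 _ _) (X.arrowBr_self h2 P Q)
  br₁_cyc P Q R := Prod.ext (X.br_cyc _ _ _) (X.arrowBr_cyc P Q R)
  s_Jac _ _ _ _ _ := rfl
  t_Jac := X.TObj_t_Jac
  Jac_iso _ _ _ _ _ := TwoVect.isIso _ _
  Jac_nat := X.TObj_Jac_nat
  Jac_alt x₁ x₂ x y := Prod.ext
    ((congrArg (X.br x₁ x₂) (X.br_self h2 x y)).trans (map_zero _)) (X.J_alt x₁ x₂ x y)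
  Jac_cyc x₁ x₂ x y z := by
    simp only [pentalin_apply, Prod.mk_add_mk, X.J_cyc, ← map_add, X.br_cyc, map_zero]
    rfl
  Jac_coh := X.TObj_Jac_coh

end

section

variable {X Y : HLTS.{w, u} k} (h2 : (2 : k) ≠ 0)

theorem Hom.TMap_coh (φ : Hom X Y) (x₁ x₂ x₃ x₄ x₅ : X.X₀) :
    let L := TObj Y.toHLTSData
    let F := TMap φ.toHomData
    L.Commutes
    [L.Jac (F.F₀ x₁) (F.F₀ x₂) (F.F₀ x₃) (F.F₀ x₄) (F.F₀ x₅),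
     L.br₁ (F.F₂ x₁ x₂ x₃) (L.one (F.F₀ x₄)) (L.one (F.F₀ x₅))
      + L.br₁ (L.one (F.F₀ x₃)) (F.F₂ x₁ x₂ x₄) (L.one (F.F₀ x₅))
      + L.br₁ (L.one (F.F₀ x₃)) (L.one (F.F₀ x₄)) (F.F₂ x₁ x₂ x₅),
     F.F₂ (X.br x₁ x₂ x₃) x₄ x₅ + F.F₂ x₃ (X.br x₁ x₂ x₄) x₅ + F.F₂ x₃ x₄ (X.br x₁ x₂ x₅)]
    [L.br₁ (L.one (F.F₀ x₁)) (L.one (F.F₀ x₂)) (F.F₂ x₃ x₄ x₅),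
     F.F₂ x₁ x₂ (X.br x₃ x₄ x₅),
     F.F₁ ((TObj X.toHLTSData).Jac x₁ x₂ x₃ x₄ x₅)] := by
  have h := φ.coh x₁ x₂ x₃ x₄ x₅
  rw [TObj_commutes_iff]
  simp only [List.isChain_cons_cons, List.isChain_singleton, and_true, List.map_cons,
    List.map_nil, List.sum_cons, List.sum_nil, TMap, TMapF₂, map_add, trilin_apply,
    pentalin_apply, LinearMap.inl_apply, LinearMap.fst_apply, LinearMap.prodMap_apply,
    LinearMap.snd_apply, LinearMap.comp_apply, LinearMap.add_apply, Prod.mk_add_mk, Y.d_J,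
    Y.d_brR, Y.d_brM, Y.d_brL, φ.d_φ₂, map_sub, LinearMap.sub_apply, map_zero,
    LinearMap.zero_apply, add_zero, zero_add]
  refine ⟨⟨by abel, by abel⟩, ⟨by abel, by abel⟩, trivial, ?_⟩
  linear_combination (norm := abel) h

/-- The homomorphism of Lie triple 2-systems assigned to a homomorphism of 2-term homotopy Lie
triple systems. -/
def Hom.toLT2 (φ : Hom X Y) : LT2.Hom (X.toLT2 h2) (Y.toLT2 h2) where
  toHomData := TMap φ.toHomData
  s_F₁ _ := rfl
  t_F₁ P := (φ.map_target P).symm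
  F₁_one _ := Prod.ext rfl (map_zero φ.φ₁)
  F₁_comp P Q h := TwoVect.commutes_of_cmp_eq ((φ.map_target P).symm.trans (congrArg φ.φ₀ h))
    (Prod.ext rfl (map_add φ.φ₁ P.2 Q.2).symm)
  s_F₂ _ _ _ := rfl
  t_F₂ := φ.br_add_d_φ₂
  F₂_nat P Q R := by
    refine TObj_commutes_pair ?_ (φ.br_add_d_φ₂ P.1 Q.1 R.1) rfl (φ.arrowBr_nat P Q R)
    rw [TObj_t_br]
    exact (congrArg₂ (fun a b => Y.br a b _) (φ.map_target P) (φ.map_target Q)).symm.trans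
      (congrArg _ (φ.map_target R).symm)
  alt x y := Prod.ext (Y.br_self h2 _ _) (φ.alt x y)
  cyc x y z := by
    refine Prod.ext ?_ (φ.cyc x y z)
    change Y.br _ _ _ = -Y.br _ _ _ - Y.br _ _ _
    linear_combination (norm := abel) Y.br_cyc (φ.φ₀ x) (φ.φ₀ y) (φ.φ₀ z)
  coh := φ.TMap_coh

/-- The 2-homomorphism of Lie triple 2-systems assigned to a 2-homomorphism of 2-term homotopy Lie
triple systems. -/
def TwoHom.toLT2 {φ ψ : Hom X Y} (σ : TwoHom φ ψ) : LT2.TwoHom (φ.toLT2 h2) (ψ.toLT2 h2) where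
  θ := TMap₂ σ
  s_θ _ := rfl
  t_θ := σ.φ₀_add_d_τ
  nat P := TObj_commutes_pair (φ.map_target P).symm (σ.φ₀_add_d_τ P.1) rfl (by
    change φ.φ₁ P.2 + σ.τ (P.1 + X.d P.2) = σ.τ P.1 + ψ.φ₁ P.2
    rw [map_add, σ.τ_d]
    abel)
  coh x y z := by
    refine TObj_commutes_pair (φ.br_add_d_φ₂ x y z) ?_ rfl (σ.arrowBr_nat x y z)
    rw [TObj_t_br]
    change Y.br (φ.φ₀ x + _) (φ.φ₀ y + _) (φ.φ₀ z + _) = Y.br (ψ.φ₀ x) (ψ.φ₀ y) (ψ.φ₀ z)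
    simp only [← σ.φ₀_add_d_τ]
    rfl

end

end HLTS

namespace LT2

section

variable (L : LT2.{w, u} k)

theorem br₀_skew (x y z) : L.br₀ x y z = -L.br₀ y x z := by
  have h := L.br₀_alt (x + y) z
  simp only [map_add, LinearMap.add_apply, L.br₀_alt, zero_add, add_zero] at h
  exact eq_neg_of_add_eq_zero_right h

theorem br₁_skew (f g h) : L.br₁ f g h = -L.br₁ g f h := by
  have halt := L.br₁_alt (f + g) h
  simp only [map_add, LinearMap.add_apply, L.br₁_alt, zero_add, add_zero] at halt
  exact eq_neg_of_add_eq_zero_right halt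

theorem arrow_br₁_one_one (f x y) :
    L.arrow (L.br₁ f (L.one x) (L.one y)) = (SObj L).brL (L.arrow f) x y :=
  Subtype.ext (by simp [TwoVect.coe_arrow, L.s_br, L.s_one, L.br_one])

theorem arrow_one_br₁_one (x f y) :
    L.arrow (L.br₁ (L.one x) f (L.one y)) = (SObj L).brM x (L.arrow f) y :=
  Subtype.ext (by simp [TwoVect.coe_arrow, L.s_br, L.s_one, L.br_one])

theorem arrow_one_one_br₁ (x y f) :
    L.arrow (L.br₁ (L.one x) (L.one y) f) = (SObj L).brR x y (L.arrow f) :=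
  Subtype.ext (by simp [TwoVect.coe_arrow, L.s_br, L.s_one, L.br_one])

theorem arrow_br₁_comp (f f' g g' h h' : L.Mor) (hf : L.t f = L.s f') (hg : L.t g = L.s g')
    (hh : L.t h = L.s h') :
    L.arrow (L.br₁ (L.cmp f f' hf) (L.cmp g g' hg) (L.cmp h h' hh)) =
      L.arrow (L.br₁ f g h) + L.arrow (L.br₁ f' g' h') := by
  have := ((L.commutes_iff_sum_arrow_eq _ _ _ _).1 (L.br_comp f f' g g' h h' hf hg hh)).2.2.2
  simpa using this.symm

theorem arrow_br₁ (f g h : L.Mor) : L.arrow (L.br₁ f g h) =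
    (SObj L).arrowBr (L.s f, L.arrow f) (L.s g, L.arrow g) (L.s h, L.arrow h) := by
  have hfgh := L.arrow_br₁_comp f (L.one (L.t f)) (L.one (L.s g)) g (L.one (L.s h)) h
    (L.s_one _).symm (L.t_one _) (L.t_one _)
  have hgh := L.arrow_br₁_comp (L.one (L.t f)) (L.one (L.t f)) g (L.one (L.t g))
    (L.one (L.s h)) h (by rw [L.s_one, L.t_one]) (L.s_one _).symm (L.t_one _)
  simp only [TwoVect.cmp_eq, L.t_one, add_sub_cancel_right, add_sub_cancel_left] at hfgh hgh
  rw [hfgh, hgh, arrow_br₁_one_one, arrow_one_br₁_one, arrow_one_one_br₁, HLTSData.arrowBr_eq,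
    L.t_eq_s_add_t_arrow f, L.t_eq_s_add_t_arrow g, add_assoc]
  rfl

theorem SObj_brR_skew (x y) (f : LinearMap.ker L.s) : (SObj L).brR x y f = -(SObj L).brR y x f :=
  Subtype.ext (L.br₁_skew _ _ _)

theorem SObj_brM_skew (x) (f : LinearMap.ker L.s) (y) : (SObj L).brM x f y = -(SObj L).brL f x y :=
  Subtype.ext (L.br₁_skew _ _ _)

theorem SObj_brR_cyc (x y) (f : LinearMap.ker L.s) :
    (SObj L).brR x y f + (SObj L).brM y f x + (SObj L).brL f x y = 0 :=
  Subtype.ext (L.br₁_cyc _ _ _)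

theorem SObj_brM_d (f g : LinearMap.ker L.s) (x) :
    (SObj L).brM (L.t f) g x = (SObj L).brL f (L.t g) x := by
  have h := congrArg L.arrow (L.br₁_skew f g (L.one x))
  simp only [arrow_br₁, map_neg, HLTSData.arrowBr_eq, TwoVect.arrow_coe, LinearMap.map_coe_ker,
    L.arrow_one, map_zero, LinearMap.zero_apply, zero_add, add_zero, L.s_one] at h
  exact h.trans (neg_eq_iff_eq_neg.2 (L.SObj_brM_skew _ _ _))

theorem SObj_brR_d (f g : LinearMap.ker L.s) (x) :
    (SObj L).brR (L.t f) x g = (SObj L).brL f x (L.t g) := by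
  have h := congrArg L.arrow (L.br₁_cyc f (L.one x) g)
  simp only [arrow_br₁, map_add, HLTSData.arrowBr_eq, TwoVect.arrow_coe, LinearMap.map_coe_ker,
    L.arrow_one, map_zero, LinearMap.zero_apply, zero_add, add_zero, L.s_one] at h
  exact (eq_neg_of_add_eq_zero_left ((add_assoc _ _ _).symm.trans h)).trans
    (eq_neg_of_add_eq_zero_right (L.SObj_brR_cyc x (L.t g) f)).symm

theorem arrow_Jac_nat (f₁ f₂ f₃ f₄ f₅ : L.Mor) :
    L.arrow (L.br₁ f₁ f₂ (L.br₁ f₃ f₄ f₅))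
        + (SObj L).J (L.t f₁) (L.t f₂) (L.t f₃) (L.t f₄) (L.t f₅) =
      (SObj L).J (L.s f₁) (L.s f₂) (L.s f₃) (L.s f₄) (L.s f₅)
        + (L.arrow (L.br₁ (L.br₁ f₁ f₂ f₃) f₄ f₅) + L.arrow (L.br₁ f₃ (L.br₁ f₁ f₂ f₄) f₅)
          + L.arrow (L.br₁ f₃ f₄ (L.br₁ f₁ f₂ f₅))) := by
  have h := ((L.commutes_iff_sum_arrow_eq _ _ _ _).1 (L.Jac_nat f₁ f₂ f₃ f₄ f₅)).2.2.2
  simpa only [List.map_cons, List.map_nil, List.sum_cons, List.sum_nil, add_zero, map_add,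
    pentalin_apply] using h

theorem SObj_d_J (x₁ x₂ x₃ x₄ x₅) : L.t ((SObj L).J x₁ x₂ x₃ x₄ x₅) =
    -L.br₀ x₁ x₂ (L.br₀ x₃ x₄ x₅) + L.br₀ x₃ (L.br₀ x₁ x₂ x₄) x₅ + L.br₀ (L.br₀ x₁ x₂ x₃) x₄ x₅
      + L.br₀ x₃ x₄ (L.br₀ x₁ x₂ x₅) := by
  have h := L.t_eq_s_add_t_arrow (L.Jac x₁ x₂ x₃ x₄ x₅)
  rw [L.t_Jac, L.s_Jac] at h
  change L.t (L.arrow _) = _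
  linear_combination (norm := abel) -h

theorem SObj_J_d₁ (f : LinearMap.ker L.s) (x₂ x₃ x₄ x₅) : (SObj L).J (L.t f) x₂ x₃ x₄ x₅ =
    -(SObj L).brL f x₂ (L.br₀ x₃ x₄ x₅) + (SObj L).brM x₃ ((SObj L).brL f x₂ x₄) x₅
      + (SObj L).brL ((SObj L).brL f x₂ x₃) x₄ x₅ + (SObj L).brR x₃ x₄ ((SObj L).brL f x₂ x₅) := by
  have h := L.arrow_Jac_nat f (L.one x₂) (L.one x₃) (L.one x₄) (L.one x₅)
  simp only [L.br_one, arrow_br₁_one_one, arrow_one_br₁_one, arrow_one_one_br₁, L.s_one, L.t_one,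
    TwoVect.arrow_coe, LinearMap.map_coe_ker, map_zero, LinearMap.zero_apply, zero_add] at h
  linear_combination (norm := abel) h

theorem SObj_J_d₂ (x₁) (f : LinearMap.ker L.s) (x₃ x₄ x₅) : (SObj L).J x₁ (L.t f) x₃ x₄ x₅ =
    -(SObj L).brM x₁ f (L.br₀ x₃ x₄ x₅) + (SObj L).brM x₃ ((SObj L).brM x₁ f x₄) x₅
      + (SObj L).brL ((SObj L).brM x₁ f x₃) x₄ x₅ + (SObj L).brR x₃ x₄ ((SObj L).brM x₁ f x₅) := by
  have h := L.arrow_Jac_nat (L.one x₁) f (L.one x₃) (L.one x₄) (L.one x₅)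
  simp only [L.br_one, arrow_br₁_one_one, arrow_one_br₁_one, arrow_one_one_br₁, L.s_one, L.t_one,
    TwoVect.arrow_coe, LinearMap.map_coe_ker, map_zero, LinearMap.zero_apply, zero_add] at h
  linear_combination (norm := abel) h

theorem SObj_J_d₃ (x₁ x₂) (f : LinearMap.ker L.s) (x₄ x₅) : (SObj L).J x₁ x₂ (L.t f) x₄ x₅ =
    -(SObj L).brR x₁ x₂ ((SObj L).brL f x₄ x₅) + (SObj L).brL f (L.br₀ x₁ x₂ x₄) x₅
      + (SObj L).brL ((SObj L).brR x₁ x₂ f) x₄ x₅ + (SObj L).brL f x₄ (L.br₀ x₁ x₂ x₅) := by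
  have h := L.arrow_Jac_nat (L.one x₁) (L.one x₂) f (L.one x₄) (L.one x₅)
  simp only [L.br_one, arrow_br₁_one_one, arrow_one_one_br₁, L.s_one, L.t_one,
    TwoVect.arrow_coe, LinearMap.map_coe_ker, map_zero, LinearMap.zero_apply, zero_add] at h
  linear_combination (norm := abel) h

theorem SObj_J_d₅ (x₁ x₂ x₃ x₄) (f : LinearMap.ker L.s) : (SObj L).J x₁ x₂ x₃ x₄ (L.t f) =
    -(SObj L).brR x₁ x₂ ((SObj L).brR x₃ x₄ f) + (SObj L).brR x₃ (L.br₀ x₁ x₂ x₄) f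
      + (SObj L).brR (L.br₀ x₁ x₂ x₃) x₄ f + (SObj L).brR x₃ x₄ ((SObj L).brR x₁ x₂ f) := by
  have h := L.arrow_Jac_nat (L.one x₁) (L.one x₂) (L.one x₃) (L.one x₄) f
  simp only [L.br_one, arrow_one_one_br₁, L.s_one, L.t_one, TwoVect.arrow_coe,
    LinearMap.map_coe_ker, map_zero, zero_add] at h
  linear_combination (norm := abel) h

/-- The 2-term homotopy Lie triple system assigned to a Lie triple 2-system. -/
abbrev toHLTS : HLTS.{w, u} k where
  toHLTSData := SObj L
  d_brR x y f := by simp [L.t_br, L.t_one]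
  d_brM x f y := by simp [L.t_br, L.t_one]
  brM_d := L.SObj_brM_d
  brR_d f x g := L.SObj_brR_d f g x
  br_skew := L.br₀_skew
  brR_skew := L.SObj_brR_skew
  brM_skew := L.SObj_brM_skew
  br_cyc := L.br₀_cyc
  brR_cyc := L.SObj_brR_cyc
  J_alt x₁ x₂ x y := (congrArg L.arrow (L.Jac_alt x₁ x₂ x y)).trans (map_zero _)
  J_cyc x₁ x₂ x y z := by
    have h := congrArg L.arrow (L.Jac_cyc x₁ x₂ x y z)
    rwa [map_add, map_add, map_zero] at h
  d_J := L.SObj_d_J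
  J_d₁ := L.SObj_J_d₁
  J_d₂ := L.SObj_J_d₂
  J_d₃ := L.SObj_J_d₃
  J_d₅ := L.SObj_J_d₅
  J_coh x₁ x₂ x₃ x₄ x₅ x₆ x₇ := by
    have h := ((L.commutes_iff_sum_arrow_eq _ _ _ _).1 (L.Jac_coh x₁ x₂ x₃ x₄ x₅ x₆ x₇)).2.2.2
    simp only [List.map_cons, List.map_nil, List.sum_cons, List.sum_nil, map_add,
      arrow_br₁_one_one, arrow_one_br₁_one, arrow_one_one_br₁, L.arrow_one, add_zero] at h
    simp only [pentalin_apply]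
    linear_combination (norm := abel) h

end

section

variable {L M : LT2.{w, u} k}

theorem Hom.arrow_F₁ (F : Hom L M) (f : L.Mor) :
    M.arrow (F.F₁ f) = (SMap F).φ₁ (L.arrow f) :=
  Subtype.ext (by simp [SMap, TwoVect.coe_arrow, F.s_F₁, F.F₁_one])

theorem Hom.arrow_F₂_nat (F : Hom L M) (f g h : L.Mor) :
    M.arrow (M.br₁ (F.F₁ f) (F.F₁ g) (F.F₁ h)) + (SMap F).φ₂ (L.t f) (L.t g) (L.t h) =
      (SMap F).φ₂ (L.s f) (L.s g) (L.s h) + (SMap F).φ₁ (L.arrow (L.br₁ f g h)) := by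
  have hnat := ((M.commutes_iff_sum_arrow_eq _ _ _ _).1 (F.F₂_nat f g h)).2.2.2
  simp only [List.map_cons, List.map_nil, List.sum_cons, List.sum_nil, add_zero,
    F.arrow_F₁] at hnat
  exact hnat

/-- The homomorphism of 2-term homotopy Lie triple systems assigned to a homomorphism of Lie triple
2-systems. -/
def Hom.toHLTS (F : Hom L M) : HLTS.Hom L.toHLTS M.toHLTS where
  toHomData := SMap F
  chain f := (F.t_F₁ f).symm
  alt x y := (congrArg M.arrow (F.alt x y)).trans (map_zero _)
  cyc x y z := by
    have h := congrArg M.arrow (F.cyc x y z)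
    rwa [map_sub, map_neg] at h
  d_φ₂ x y z := by
    have h := M.t_eq_s_add_t_arrow (F.F₂ x y z)
    rw [F.t_F₂, F.s_F₂] at h
    exact eq_sub_of_add_eq' h.symm
  φ₂_R x y f := by
    have h := F.arrow_F₂_nat (L.one x) (L.one y) f
    simp only [F.F₁_one, arrow_one_one_br₁, F.arrow_F₁, L.t_one, L.s_one, TwoVect.arrow_coe,
      LinearMap.map_coe_ker, map_zero, zero_add] at h
    exact eq_sub_of_add_eq' h
  φ₂_M x f y := by
    have h := F.arrow_F₂_nat (L.one x) f (L.one y)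
    simp only [F.F₁_one, arrow_one_br₁_one, F.arrow_F₁, L.t_one, L.s_one, TwoVect.arrow_coe,
      LinearMap.map_coe_ker, map_zero, LinearMap.zero_apply, zero_add] at h
    exact eq_sub_of_add_eq' h
  coh x₁ x₂ x₃ x₄ x₅ := by
    have h := ((M.commutes_iff_sum_arrow_eq _ _ _ _).1 (F.coh x₁ x₂ x₃ x₄ x₅)).2.2.2
    simp only [List.map_cons, List.map_nil, List.sum_cons, List.sum_nil, map_add, F.arrow_F₁,
      arrow_br₁_one_one, arrow_one_br₁_one, arrow_one_one_br₁, add_zero] at h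
    simp only [SMap, SMapφ₂, trilin_apply, pentalin_apply] at h ⊢
    linear_combination (norm := abel) h

/-- The 2-homomorphism of 2-term homotopy Lie triple systems assigned to a 2-homomorphism of Lie
triple 2-systems. -/
def TwoHom.toHLTS {F G : Hom L M} (σ : TwoHom F G) : HLTS.TwoHom F.toHLTS G.toHLTS where
  τ := SMap₂ σ
  d_τ x := by
    have h := M.t_eq_s_add_t_arrow (σ.θ x)
    rw [σ.t_θ, σ.s_θ] at h
    exact eq_sub_of_add_eq' h.symm
  τ_d f := by
    have h := ((M.commutes_iff_sum_arrow_eq _ _ _ _).1 (σ.nat f)).2.2.2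
    simp only [List.map_cons, List.map_nil, List.sum_cons, List.sum_nil, Hom.arrow_F₁,
      TwoVect.arrow_coe, LinearMap.map_coe_ker, map_zero, add_zero, zero_add] at h
    exact eq_sub_of_add_eq' h
  coh x y z := by
    have h := ((M.commutes_iff_sum_arrow_eq _ _ _ _).1 (σ.coh x y z)).2.2.2
    simp only [List.map_cons, List.map_nil, List.sum_cons, List.sum_nil, arrow_br₁, σ.s_θ,
      HLTSData.arrowBr, add_zero] at h
    exact sub_eq_sub_iff_add_eq_add.2 h

end

end LT2

namespace HLTS

theorem eqToHom_comp_τ {X Y : HLTS.{w, u} k} {φ ψ χ : Hom X Y} (h : φ = ψ) (σ : ψ ⟶ χ) :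
    TwoHom.τ (eqToHom h ≫ σ) = TwoHom.τ σ := by
  rw [comp_τ, eqToHom_τ, zero_add]

theorem comp_eqToHom_τ {X Y : HLTS.{w, u} k} {φ ψ χ : Hom X Y} (σ : φ ⟶ ψ) (h : ψ = χ) :
    TwoHom.τ (σ ≫ eqToHom h) = TwoHom.τ σ := by
  rw [comp_τ, eqToHom_τ, add_zero]

end HLTS

namespace LT2

theorem eqToHom_comp_θ {L M : LT2.{w, u} k} {F G H : Hom L M} (h : F = G) (σ : G ⟶ H) (x : L.Ob) :
    TwoHom.θ (eqToHom h ≫ σ) x = TwoHom.θ σ x := by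
  subst h
  rw [eqToHom_refl, Category.id_comp]

theorem comp_eqToHom_θ {L M : LT2.{w, u} k} {F G H : Hom L M} (σ : F ⟶ G) (h : G = H) (x : L.Ob) :
    TwoHom.θ (σ ≫ eqToHom h) x = TwoHom.θ σ x := by
  subst h
  rw [eqToHom_refl, Category.comp_id]

end LT2

namespace HLTS

section

variable (h2 : (2 : k) ≠ 0)

theorem Hom.toLT2_id (X : HLTS.{w, u} k) : (Hom.id X).toLT2 h2 = LT2.Hom.id (X.toLT2 h2) :=
  LT2.Hom.ext_apply rfl rfl fun _ _ _ => rfl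

theorem Hom.toLT2_comp {X Y Z : HLTS.{w, u} k} (φ : Hom X Y) (ψ : Hom Y Z) :
    (φ.comp ψ).toLT2 h2 = (φ.toLT2 h2).comp (ψ.toLT2 h2) :=
  LT2.Hom.ext_apply rfl rfl fun _ _ _ => rfl

/-- The strict 2-functor from 2-term homotopy Lie triple systems to Lie triple 2-systems. -/
def toLT2Functor : StrictPseudofunctor (HLTS.{w, u} k) (LT2.{w, u} k) :=
  StrictPseudofunctor.mk''
    { obj := fun X => X.toLT2 h2
      map := fun φ => Hom.toLT2 h2 φ
      map₂ := fun σ => TwoHom.toLT2 h2 σ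
      map₂_id := fun _ => rfl
      map₂_comp := fun _ _ => rfl
      map_id := Hom.toLT2_id h2
      map_comp := Hom.toLT2_comp h2
      map₂_whisker_left := fun _ _ _ _ => LT2.twoHom_ext fun x =>
        ((LT2.eqToHom_comp_θ _ _ x).trans (LT2.comp_eqToHom_θ _ _ x)).symm
      map₂_whisker_right := fun _ _ => LT2.twoHom_ext fun x =>
        ((LT2.eqToHom_comp_θ _ _ x).trans (LT2.comp_eqToHom_θ _ _ x)).symm }

theorem isExplicitT : IsExplicitT (toLT2Functor.{w, u} h2) where
  obj _ := rfl
  map _ := HEq.rfl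
  map₂ _ := HEq.rfl

end

end HLTS

namespace LT2

section

variable {L M N : LT2.{w, u} k}

theorem Hom.toHLTS_id (L : LT2.{w, u} k) : (Hom.id L).toHLTS = HLTS.Hom.id L.toHLTS :=
  HLTS.Hom.ext_data (HLTS.HomData.ext rfl rfl (by
    ext x y z : 3
    exact L.arrow_one _))

theorem Hom.toHLTS_comp (F : Hom L M) (G : Hom M N) :
    (F.comp G).toHLTS = F.toHLTS.comp G.toHLTS :=
  HLTS.Hom.ext_data (HLTS.HomData.ext rfl rfl (by
    ext x y z : 3
    exact (N.arrow_cmp _ _ _).trans (congrArg _ (G.arrow_F₁ _))))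

theorem TwoHom.toHLTS_id (F : Hom L M) : (TwoHom.id F).toHLTS = HLTS.TwoHom.id F.toHLTS :=
  HLTS.TwoHom.ext (LinearMap.ext fun _ => M.arrow_one _)

theorem TwoHom.toHLTS_vcomp {F G H : Hom L M} (σ : TwoHom F G) (τ : TwoHom G H) :
    (σ.vcomp τ).toHLTS = σ.toHLTS.vcomp τ.toHLTS :=
  HLTS.TwoHom.ext (LinearMap.ext fun _ => M.arrow_cmp _ _ _)

theorem TwoHom.toHLTS_whiskerLeft_τ (F : Hom L M) {G H : Hom M N} (σ : TwoHom G H) :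
    (TwoHom.whiskerLeft F σ).toHLTS.τ = (HLTS.TwoHom.whiskerLeft F.toHLTS σ.toHLTS).τ := rfl

theorem TwoHom.toHLTS_whiskerRight_τ {F G : Hom L M} (σ : TwoHom F G) (H : Hom M N) :
    (TwoHom.whiskerRight σ H).toHLTS.τ = (HLTS.TwoHom.whiskerRight σ.toHLTS H.toHLTS).τ :=
  LinearMap.ext fun _ => H.arrow_F₁ _

theorem TwoHom.toHLTS_whiskerLeft (F : Hom L M) {G H : Hom M N} (σ : TwoHom G H) :
    ((TwoHom.whiskerLeft F σ).toHLTS : (F.comp G).toHLTS ⟶ (F.comp H).toHLTS) =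
      eqToHom (Hom.toHLTS_comp F G) ≫ (HLTS.TwoHom.whiskerLeft F.toHLTS σ.toHLTS :
        F.toHLTS.comp G.toHLTS ⟶ F.toHLTS.comp H.toHLTS) ≫ eqToHom (Hom.toHLTS_comp F H).symm :=
  HLTS.twoHom_ext ((TwoHom.toHLTS_whiskerLeft_τ F σ).trans
    ((HLTS.eqToHom_comp_τ _ _).trans (HLTS.comp_eqToHom_τ _ _)).symm)

theorem TwoHom.toHLTS_whiskerRight {F G : Hom L M} (σ : TwoHom F G) (H : Hom M N) :
    ((TwoHom.whiskerRight σ H).toHLTS : (F.comp H).toHLTS ⟶ (G.comp H).toHLTS) =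
      eqToHom (Hom.toHLTS_comp F H) ≫ (HLTS.TwoHom.whiskerRight σ.toHLTS H.toHLTS :
        F.toHLTS.comp H.toHLTS ⟶ G.toHLTS.comp H.toHLTS) ≫ eqToHom (Hom.toHLTS_comp G H).symm :=
  HLTS.twoHom_ext ((TwoHom.toHLTS_whiskerRight_τ σ H).trans
    ((HLTS.eqToHom_comp_τ _ _).trans (HLTS.comp_eqToHom_τ _ _)).symm)

end

/-- The strict 2-functor from Lie triple 2-systems to 2-term homotopy Lie triple systems. -/
def toHLTSFunctor : StrictPseudofunctor (LT2.{w, u} k) (HLTS.{w, u} k) :=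
  StrictPseudofunctor.mk''
    { obj := fun L => L.toHLTS
      map := fun F => Hom.toHLTS F
      map₂ := fun σ => TwoHom.toHLTS σ
      map₂_id := fun F => TwoHom.toHLTS_id F
      map₂_comp := fun σ τ => TwoHom.toHLTS_vcomp σ τ
      map_id := Hom.toHLTS_id
      map_comp := fun F G => Hom.toHLTS_comp F G
      map₂_whisker_left := fun F _ _ σ => TwoHom.toHLTS_whiskerLeft F σ
      map₂_whisker_right := fun σ H => TwoHom.toHLTS_whiskerRight σ H }

theorem isExplicitS : IsExplicitS (toHLTSFunctor.{w, u} (k := k)) where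
  obj _ := rfl
  map _ := HEq.rfl
  map₂ _ := HEq.rfl

/-- An isomorphism of Lie triple 2-systems preserving the brackets and the fundamentor on the nose,
that is, one whose `F₂` consists of identities. -/
structure StrictIso (L M : LT2.{w, u} k) where
  /-- The bijection on objects. -/
  ob : L.Ob ≃ₗ[k] M.Ob
  /-- The bijection on morphisms. -/
  mor : L.Mor ≃ₗ[k] M.Mor
  s_mor : ∀ f, M.s (mor f) = ob (L.s f)
  t_mor : ∀ f, M.t (mor f) = ob (L.t f)
  mor_one : ∀ x, mor (L.one x) = M.one (ob x)
  ob_br₀ : ∀ x y z, ob (L.br₀ x y z) = M.br₀ (ob x) (ob y) (ob z)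
  mor_br₁ : ∀ f g h, mor (L.br₁ f g h) = M.br₁ (mor f) (mor g) (mor h)
  mor_Jac : ∀ x₁ x₂ x₃ x₄ x₅,
    mor (L.Jac x₁ x₂ x₃ x₄ x₅) = M.Jac (ob x₁) (ob x₂) (ob x₃) (ob x₄) (ob x₅)

namespace StrictIso

variable {L M N : LT2.{w, u} k}

/-- The inverse of a strict isomorphism. -/
def symm (e : StrictIso L M) : StrictIso M L where
  ob := e.ob.symm
  mor := e.mor.symm
  s_mor f := e.ob.injective (by simp [← e.s_mor])
  t_mor f := e.ob.injective (by simp [← e.t_mor])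
  mor_one x := e.mor.injective (by simp [e.mor_one])
  ob_br₀ x y z := e.ob.injective (by simp [e.ob_br₀])
  mor_br₁ f g h := e.mor.injective (by simp [e.mor_br₁])
  mor_Jac x₁ x₂ x₃ x₄ x₅ := e.mor.injective (by simp [e.mor_Jac])

/-- A strict isomorphism as a homomorphism. -/
def toHom (e : StrictIso L M) : Hom L M where
  F₀ := e.ob
  F₁ := e.mor
  F₂ := trilin (fun x y z => M.one (M.br₀ (e.ob x) (e.ob y) (e.ob z))) (by simp) (by simp)
    (by simp) (by simp) (by simp) (by simp)
  s_F₁ := e.s_mor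
  t_F₁ := e.t_mor
  F₁_one := e.mor_one
  F₁_comp f g h := TwoVect.commutes_of_cmp_eq
    ((e.t_mor f).trans ((congrArg e.ob h).trans (e.s_mor g).symm))
    (by simp [TwoVect.cmp_eq, e.t_mor, e.mor_one])
  s_F₂ _ _ _ := M.s_one _
  t_F₂ x y z := (M.t_one _).trans (e.ob_br₀ x y z).symm
  F₂_nat f g h := (M.commutes_iff_sum_arrow_eq _ _ _ _).2
    (by simp [M.t_br, M.s_br, M.s_one, M.t_one, e.s_mor, e.t_mor, e.mor_br₁, M.arrow_one])
  alt x y := by simp [M.br₀_alt]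
  cyc x y z := by
    have h := congrArg M.one (M.br₀_cyc (e.ob x) (e.ob y) (e.ob z))
    simp only [map_add, map_zero] at h
    simp only [trilin_apply]
    linear_combination (norm := abel) h
  coh x₁ x₂ x₃ x₄ x₅ := (M.commutes_iff_sum_arrow_eq _ _ _ _).2
    (by simp [M.s_one, M.t_one, M.s_Jac, M.t_Jac, e.ob_br₀, e.mor_Jac, M.br_one, M.arrow_one])

theorem toHom_comp_F₂ (e : StrictIso L M) (F : Hom M N) (x y z) :
    (e.toHom.comp F).F₂ x y z = F.F₂ (e.ob x) (e.ob y) (e.ob z) := by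
  rw [Hom.comp_F₂]
  change _ + F.F₁ (M.one _) - N.one (F.F₀ _) = _
  rw [F.F₁_one]
  exact add_sub_cancel_right (G := N.Mor) _ _

theorem comp_toHom_F₂ (F : Hom L M) (e : StrictIso M N) (x y z) :
    (F.comp e.toHom).F₂ x y z = e.mor (F.F₂ x y z) := by
  rw [Hom.comp_F₂]
  change N.one _ + _ - N.one (e.ob _) = _
  rw [e.ob_br₀]
  exact add_sub_cancel_left (G := N.Mor) _ _

theorem toHom_comp_symm (e : StrictIso L M) : e.toHom.comp e.symm.toHom = Hom.id L :=
  Hom.ext_apply (LinearMap.ext e.ob.symm_apply_apply) (LinearMap.ext e.mor.symm_apply_apply)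
    fun x y z => by
      rw [toHom_comp_F₂, Hom.id_F₂]
      simp [toHom, symm]

end StrictIso

section

variable (h2 : (2 : k) ≠ 0)

/-- A Lie triple 2-system is recovered from its objects and the morphisms with source `0`. -/
def strictIsoToLT2 (L : LT2.{w, u} k) : StrictIso L (L.toHLTS.toLT2 h2) where
  ob := LinearEquiv.refl k L.Ob
  mor := L.morEquiv
  s_mor _ := rfl
  t_mor f := (L.t_eq_s_add_t_arrow f).symm
  mor_one x := Prod.ext (L.s_one x) (L.arrow_one x)
  ob_br₀ _ _ _ := rfl
  mor_br₁ f g h := Prod.ext (L.s_br f g h) (L.arrow_br₁ f g h)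
  mor_Jac x₁ x₂ x₃ x₄ x₅ := Prod.ext (L.s_Jac x₁ x₂ x₃ x₄ x₅) rfl

theorem strictIsoToLT2_naturality {L M : LT2.{w, u} k} (F : Hom L M) :
    (F.toHLTS.toLT2 h2).comp (M.strictIsoToLT2 h2).symm.toHom =
      (L.strictIsoToLT2 h2).symm.toHom.comp F :=
  Hom.ext_apply rfl
    (LinearMap.ext fun P => by
      change M.one (F.F₀ P.1) + F.F₁ P.2 = F.F₁ (L.one P.1 + P.2)
      rw [map_add, F.F₁_one])
    fun x y z => by
      rw [StrictIso.comp_toHom_F₂, StrictIso.toHom_comp_F₂]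
      exact M.morEquiv.injective
        ((M.morEquiv.apply_symm_apply _).trans (Prod.ext (F.s_F₂ x y z).symm rfl))

theorem strictIsoToLT2_naturality₂ {L M : LT2.{w, u} k} {F G : Hom L M} (σ : TwoHom F G)
    (x : L.Ob) :
    (TwoHom.whiskerRight (σ.toHLTS.toLT2 h2) (M.strictIsoToLT2 h2).symm.toHom).θ x =
      (TwoHom.whiskerLeft (L.strictIsoToLT2 h2).symm.toHom σ).θ x :=
  M.morEquiv.injective ((M.morEquiv.apply_symm_apply _).trans (Prod.ext (σ.s_θ x).symm rfl))

/-- The 2-natural isomorphism from `TS` to the identity. -/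
def fromTSIso : TwoNatIso
    (toHLTSFunctor.comp (HLTS.toLT2Functor h2)) (StrictPseudofunctor.id (LT2.{w, u} k)) where
  app L := (L.strictIsoToLT2 h2).symm.toHom
  inv L := (L.strictIsoToLT2 h2).toHom
  app_inv L := (L.strictIsoToLT2 h2).symm.toHom_comp_symm
  inv_app L := (L.strictIsoToLT2 h2).toHom_comp_symm
  naturality F := strictIsoToLT2_naturality h2 F
  naturality₂ σ := twoHom_ext fun x => (comp_eqToHom_θ _ _ x).trans
    ((strictIsoToLT2_naturality₂ h2 σ x).trans (eqToHom_comp_θ _ _ x).symm)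

end

end LT2

namespace HLTS

/-- An isomorphism of 2-term homotopy Lie triple systems preserving the brackets and `J` on the
nose, that is, one with `φ₂ = 0`. -/
structure StrictIso (X Y : HLTS.{w, u} k) where
  /-- The bijection in degree `0`. -/
  zero : X.X₀ ≃ₗ[k] Y.X₀
  /-- The bijection in degree `-1`. -/
  one : X.X₁ ≃ₗ[k] Y.X₁
  zero_d : ∀ f, zero (X.d f) = Y.d (one f)
  zero_br : ∀ x y z, zero (X.br x y z) = Y.br (zero x) (zero y) (zero z)
  one_brM : ∀ x f y, one (X.brM x f y) = Y.brM (zero x) (one f) (zero y)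
  one_brR : ∀ x y f, one (X.brR x y f) = Y.brR (zero x) (zero y) (one f)
  one_J : ∀ x₁ x₂ x₃ x₄ x₅,
    one (X.J x₁ x₂ x₃ x₄ x₅) = Y.J (zero x₁) (zero x₂) (zero x₃) (zero x₄) (zero x₅)

namespace StrictIso

variable {X Y : HLTS.{w, u} k}

/-- The inverse of a strict isomorphism. -/
def symm (e : StrictIso X Y) : StrictIso Y X where
  zero := e.zero.symm
  one := e.one.symm
  zero_d f := e.zero.injective (by simp [e.zero_d])
  zero_br x y z := e.zero.injective (by simp [e.zero_br])
  one_brM x f y := e.one.injective (by simp [e.one_brM])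
  one_brR x y f := e.one.injective (by simp [e.one_brR])
  one_J x₁ x₂ x₃ x₄ x₅ := e.one.injective (by simp [e.one_J])

/-- A strict isomorphism as a homomorphism. -/
def toHom (e : StrictIso X Y) : Hom X Y where
  φ₀ := e.zero
  φ₁ := e.one
  φ₂ := 0
  chain := e.zero_d
  alt := by simp
  cyc := by simp
  d_φ₂ := by simp [e.zero_br]
  φ₂_R := by simp [e.one_brR]
  φ₂_M := by simp [e.one_brM]
  coh := by simp [e.one_J]

theorem toHom_comp_symm (e : StrictIso X Y) : e.toHom.comp e.symm.toHom = Hom.id X :=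
  Hom.ext_data (HomData.ext (LinearMap.ext e.zero.symm_apply_apply)
    (LinearMap.ext e.one.symm_apply_apply) (by
      ext x y z
      exact (zero_add _).trans (map_zero e.one.symm)))

end StrictIso

section

variable (h2 : (2 : k) ≠ 0)

/-- A 2-term homotopy Lie triple system is recovered from the Lie triple 2-system assigned to it. -/
def strictIsoOfToLT2 (X : HLTS.{w, u} k) : StrictIso (X.toLT2 h2).toHLTS X where
  zero := LinearEquiv.refl k X.X₀
  one := TObjKerEquiv X.toHLTSData
  zero_d f := add_eq_right.2 (show f.1.1 = 0 from f.2)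
  zero_br _ _ _ := rfl
  one_brM x f y := by
    change X.arrowBr (x, 0) f (y, 0) = X.brM x f.1.2 y
    simp [HLTSData.arrowBr]
  one_brR x y f := by
    change X.arrowBr (x, 0) (y, 0) f = X.brR x y f.1.2
    simp [HLTSData.arrowBr]
  one_J _ _ _ _ _ := TObjKerEquiv_arrow _ _

theorem strictIsoOfToLT2_naturality {X Y : HLTS.{w, u} k} (φ : Hom X Y) :
    (φ.toLT2 h2).toHLTS.comp (Y.strictIsoOfToLT2 h2).toHom =
      (X.strictIsoOfToLT2 h2).toHom.comp φ :=
  Hom.ext_data (HomData.ext rfl rfl (by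
    ext x y z
    change 0 + TObjKerEquiv Y.toHLTSData ((TObj Y.toHLTSData).arrow (_, φ.φ₂ x y z)) =
      φ.φ₂ x y z + φ.φ₁ 0
    rw [TObjKerEquiv_arrow, map_zero, zero_add, add_zero]))

theorem strictIsoOfToLT2_naturality₂ {X Y : HLTS.{w, u} k} {φ ψ : Hom X Y} (σ : TwoHom φ ψ) :
    (TwoHom.whiskerRight (σ.toLT2 h2).toHLTS (Y.strictIsoOfToLT2 h2).toHom).τ =
      (TwoHom.whiskerLeft (X.strictIsoOfToLT2 h2).toHom σ).τ :=
  LinearMap.ext fun _ => TObjKerEquiv_arrow _ _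

/-- The 2-natural isomorphism from `ST` to the identity. -/
def fromSTIso : TwoNatIso
    ((toLT2Functor h2).comp LT2.toHLTSFunctor) (StrictPseudofunctor.id (HLTS.{w, u} k)) where
  app X := (X.strictIsoOfToLT2 h2).toHom
  inv X := (X.strictIsoOfToLT2 h2).symm.toHom
  app_inv X := (X.strictIsoOfToLT2 h2).toHom_comp_symm
  inv_app X := (X.strictIsoOfToLT2 h2).symm.toHom_comp_symm
  naturality φ := strictIsoOfToLT2_naturality h2 φ
  naturality₂ σ := twoHom_ext ((comp_eqToHom_τ _ _).trans
    ((strictIsoOfToLT2_naturality₂ h2 σ).trans (eqToHom_comp_τ _ _).symm))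

end

end HLTS

end LieTriple

theorem mainTheorem5 (k : Type w) [Field k] (h2 : (2 : k) ≠ 0) :
    ∃ (T : StrictPseudofunctor (LieTriple.HLTS.{w, u} k) (LieTriple.LT2.{w, u} k))
      (S : StrictPseudofunctor (LieTriple.LT2.{w, u} k) (LieTriple.HLTS.{w, u} k)),
      LieTriple.IsExplicitT T ∧ LieTriple.IsExplicitS S ∧ LieTriple.AreTwoEquivalences T S :=
  ⟨LieTriple.HLTS.toLT2Functor h2, LieTriple.LT2.toHLTSFunctor, LieTriple.HLTS.isExplicitT h2,
    LieTriple.LT2.isExplicitS, ⟨LieTriple.LT2.fromTSIso h2⟩, ⟨LieTriple.HLTS.fromSTIso h2⟩⟩
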